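/- Let $G$ be a finite simple graph with vertex set $\mathsf V$ and edge set $\mathsf E$, $n=|\mathsf V|$, $m=|\mathsf E|$, in which every vertex $\mathsf v$ has degree $d_{\mathsf v}\ge 1$. Each edge $\mathsf e$ has a length $\ell_{\mathsf e}\in(0,\infty)$ and is parametrized by $[0,\ell_{\mathsf e}]$. Let $c_{\mathsf e}\in C[0,\ell_{\mathsf e}]$ be real with $c_{\mathsf e}\ge c_0$ a.e. for some constant $c_0>0$ and all $\mathsf e$, and let $0\le p_{\mathsf e}\in L^\infty(0,\ell_{\mathsf e})$. Let $\mathcal H=\prod_{\mathsf e}L^2(0,\ell_{\mathsf e})$ (real, with its Hilbert space norm), and $$A_{\max}u=\big((c_{\mathsf e}u_{\mathsf e}')'-p_{\mathsf e}u_{\mathsf e}\big)_{\mathsf e},\qquad D(A_{\max})=\{u\in\mathcal H:\ u_{\mathsf e}\in H^1(0,\ell_{\mathsf e}),\ c_{\mathsf e}u_{\mathsf e}'\in H^1(0,\ell_{\mathsf e})\ \text{for all }\mathsf e\},$$ so that $D(A_{\max})=\prod_{\mathsf e}H^2(0,\ell_{\mathsf e})$ if all $c_{\mathsf e}$ are Lipschitz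 continuous. For a vertex $\mathsf v$ with incident edges $\mathsf e_1,\dots,\mathsf e_{d_{\mathsf v}}$ (in any fixed order) and $u\in D(A_{\max})$, let $U(\mathsf v)\in\mathbb R^{d_{\mathsf v}}$ be the vector of the values $u_{\mathsf e_i}(\mathsf v)$ and $U'(\mathsf v)\in\mathbb R^{d_{\mathsf v}}$ the vector of the derivatives $u_{\mathsf e_i}'(\mathsf v)$ taken in the direction away from $\mathsf v$; let $I_{\mathsf v}\in\mathbb R^{(d_{\mathsf v}-1)\times d_{\mathsf v}}$ be the bidiagonal matrix with rows $(0,\dots,0,1,-1,0,\dots,0)$, and $C(\mathsf v)^\top=(c_{\mathsf e_1}(\mathsf v),\dots,c_{\mathsf e_{d_{\mathsf v}}}(\mathsf v))$. Define $$B\colon D(A_{\max})\to\mathbb R^{2m},\qquad Bu=\begin{pmatrix}(I_{\mathsf v}U(\mathsf v))_{\mathsf v\in\mathsf V}\\(C(\mathsf v)^\top U'(\mathsf v))_{\mathsf v\in\mathsf V}\end{pmatrix},$$ and let $A$ be the restriction of $A_{\max}$ to $D(A)=\operatorname{Ker}B$. Further let $A_{K,\max}$ be the restriction of $A_{\max}$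 to $\{u\in D(A_{\max}): I_{\mathsf v}U(\mathsf v)=0\ \text{for all }\mathsf v\}$, let $B_K\colon D(A_{K,\max})\to\mathbb R^n$, $B_Ku=(C(\mathsf v)^\top U'(\mathsf v))_{\mathsf v}$, and let $A_K$ be the restriction of $A_{K,\max}$ to $\operatorname{Ker}B_K$. For an operator $T$ in $\mathcal H$ let $\rho(T)$ be the set of all real $\lambda$ such that $\lambda-T\colon D(T)\to\mathcal H$ is bijective with bounded inverse. Then the following hold. 1. $A$ generates a $C_0$-semigroup on $\mathcal H$. For every $\lambda\in\rho(A)$ the restriction $B|_{\operatorname{Ker}(\lambda-A_{\max})}\colon\operatorname{Ker}(\lambda-A_{\max})\to\mathbb R^{2m}$ is bijective, and its inverse is a bounded operator $D_{B,\lambda}\colon\mathbb R^{2m}\to\mathcal H$. 2. $A_K=A$, and this operator generates a $C_0$-semigroup on $\mathcal H$. For every $\lambda>0$, and more generally for every $\lambda\in\rho(A_K)$, the restriction $B_K|_{\operatorname{Ker}(\lambda-A_{K,\max})}\colon\operatorname{Ker}(\lambda-A_{K,\max})\to\mathbb R^{n}$ is bijective, and its inverse is a bounded operator $D_{B_K,\lambda}\colon\mathbb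 R^{n}\to\mathcal H$. -/

import Mathlib

open MeasureTheory Set Filter Topology
open scoped ENNReal NNReal ContDiff

noncomputable section

namespace QG

/-- The real Hilbert space `L²(0, ℓ)`. -/
abbrev L2 (ℓ : ℝ) : Type := Lp ℝ 2 (volume.restrict (Ioo (0 : ℝ) ℓ))

/-- `g` is the weak derivative of `f` on `(0, ℓ)`, both in `L²(0, ℓ)`. -/
def HasWeakDeriv {ℓ : ℝ} (f g : L2 ℓ) : Prop :=
  ∀ φ : ℝ → ℝ, ContDiff ℝ ∞ φ → HasCompactSupport φ → tsupport φ ⊆ Ioo 0 ℓ →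
    ∫ x in Ioo 0 ℓ, f x * deriv φ x = -∫ x in Ioo 0 ℓ, g x * φ x

theorem L2.integrable {ℓ : ℝ} (f : L2 ℓ) : IntegrableOn f (Ioo 0 ℓ) volume :=
  (Lp.memLp f).integrable (by norm_num)

theorem L2.intervalIntegrable {ℓ : ℝ} (hℓ : 0 ≤ ℓ) (f : L2 ℓ) :
    IntervalIntegrable f volume 0 ℓ := by
  rw [intervalIntegrable_iff_integrableOn_Ioo_of_le hℓ]
  exact L2.integrable f

theorem integrable_mul_test {ℓ : ℝ} {f φ : ℝ → ℝ} (hf : IntegrableOn f (Ioo 0 ℓ) volume)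
    (hφ : Continuous φ) (hc : HasCompactSupport φ) :
    IntegrableOn (fun x => f x * φ x) (Ioo 0 ℓ) volume := by
  obtain ⟨C, hC⟩ := hc.exists_bound_of_continuous hφ
  exact Integrable.mul_bdd hf hφ.aestronglyMeasurable (ae_of_all _ hC)

theorem setIntegral_test {ℓ : ℝ} {f φ : ℝ → ℝ} (h : tsupport φ ⊆ Ioo 0 ℓ) :
    ∫ x in Ioo 0 ℓ, f x * φ x = ∫ x, φ x * f x := by
  rw [← setIntegral_eq_integral_of_forall_compl_eq_zero (s := Ioo 0 ℓ) (f := fun x => φ x * f x)]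
  · simp only [mul_comm]
  · intro x hx
    have : φ x = 0 := image_eq_zero_of_notMem_tsupport (fun h' => hx (h h'))
    simp [this]

/-- An integrable function on `(0, ℓ)` that annihilates all test functions vanishes a.e. -/
theorem ae_zero_of_test {ℓ : ℝ} {f : ℝ → ℝ} (hf : IntegrableOn f (Ioo 0 ℓ) volume)
    (h : ∀ φ : ℝ → ℝ, ContDiff ℝ ∞ φ → HasCompactSupport φ → tsupport φ ⊆ Ioo 0 ℓ →
      ∫ x in Ioo 0 ℓ, f x * φ x = 0) :
    ∀ᵐ x ∂(volume.restrict (Ioo 0 ℓ)), f x = 0 := by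
  rw [ae_restrict_iff' measurableSet_Ioo]
  refine isOpen_Ioo.ae_eq_zero_of_integral_contDiff_smul_eq_zero hf.locallyIntegrableOn ?_
  intro φ h1 h2 h3
  have := h φ h1 h2 h3
  rw [setIntegral_test h3] at this
  simpa using this

theorem HasWeakDeriv.unique {ℓ : ℝ} {f g₁ g₂ : L2 ℓ} (h₁ : HasWeakDeriv f g₁)
    (h₂ : HasWeakDeriv f g₂) : g₁ = g₂ := by
  apply Lp.ext
  have : ∀ᵐ x ∂(volume.restrict (Ioo 0 ℓ)), g₁ x - g₂ x = 0 := by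
    apply ae_zero_of_test (g₁.integrable.sub (L2.integrable g₂))
    intro φ a b c
    have e := (h₁ φ a b c).symm.trans (h₂ φ a b c)
    change ∫ x in Ioo 0 ℓ, (g₁ x - g₂ x) * φ x = 0
    simp only [sub_mul]
    rw [integral_sub (integrable_mul_test (L2.integrable g₁) a.continuous b)
      (integrable_mul_test (L2.integrable g₂) a.continuous b)]
    linarith
  filter_upwards [this] with x hx
  linarith

theorem HasWeakDeriv.add {ℓ : ℝ} {f₁ f₂ g₁ g₂ : L2 ℓ} (h₁ : HasWeakDeriv f₁ g₁)
    (h₂ : HasWeakDeriv f₂ g₂) : HasWeakDeriv (f₁ + f₂) (g₁ + g₂) := by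
  intro φ a b c
  have d : Continuous (deriv φ) := a.continuous_deriv (by simp)
  have e1 : ∫ x in Ioo 0 ℓ, (f₁ + f₂ : L2 ℓ) x * deriv φ x
      = ∫ x in Ioo 0 ℓ, (f₁ x * deriv φ x + f₂ x * deriv φ x) := by
    apply integral_congr_ae
    filter_upwards [Lp.coeFn_add f₁ f₂] with x hx
    rw [hx, Pi.add_apply, add_mul]
  have e2 : ∫ x in Ioo 0 ℓ, (g₁ + g₂ : L2 ℓ) x * φ x
      = ∫ x in Ioo 0 ℓ, (g₁ x * φ x + g₂ x * φ x) := by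
    apply integral_congr_ae
    filter_upwards [Lp.coeFn_add g₁ g₂] with x hx
    rw [hx, Pi.add_apply, add_mul]
  rw [e1, e2, integral_add (integrable_mul_test (L2.integrable f₁) d b.deriv)
    (integrable_mul_test (L2.integrable f₂) d b.deriv),
    integral_add (integrable_mul_test (L2.integrable g₁) a.continuous b)
    (integrable_mul_test (L2.integrable g₂) a.continuous b), h₁ φ a b c, h₂ φ a b c]
  ring

theorem HasWeakDeriv.smul {ℓ : ℝ} {f g : L2 ℓ} (r : ℝ) (h : HasWeakDeriv f g) :
    HasWeakDeriv (r • f) (r • g) := by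
  intro φ a b c
  have e1 : ∫ x in Ioo 0 ℓ, (r • f : L2 ℓ) x * deriv φ x
      = ∫ x in Ioo 0 ℓ, r * (f x * deriv φ x) := by
    apply integral_congr_ae
    filter_upwards [Lp.coeFn_smul r f] with x hx
    rw [hx, Pi.smul_apply, smul_eq_mul, mul_assoc]
  have e2 : ∫ x in Ioo 0 ℓ, (r • g : L2 ℓ) x * φ x
      = ∫ x in Ioo 0 ℓ, r * (g x * φ x) := by
    apply integral_congr_ae
    filter_upwards [Lp.coeFn_smul r g] with x hx
    rw [hx, Pi.smul_apply, smul_eq_mul, mul_assoc]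
  rw [e1, e2, integral_const_mul, integral_const_mul, h φ a b c]
  ring

theorem HasWeakDeriv.zero {ℓ : ℝ} : HasWeakDeriv (0 : L2 ℓ) 0 := by
  intro φ a b c
  have e (ψ : ℝ → ℝ) : ∫ x in Ioo 0 ℓ, (0 : L2 ℓ) x * ψ x = 0 := by
    apply integral_eq_zero_of_ae
    filter_upwards [Lp.coeFn_zero ℝ 2 (volume.restrict (Ioo 0 ℓ))] with x hx
    rw [hx]; simp
  rw [e, e, neg_zero]

/-- Integration by parts for a primitive against a test function. -/
theorem integral_primitive_mul_deriv {ℓ : ℝ} (hℓ : 0 < ℓ) (a : ℝ) (g : L2 ℓ) {φ : ℝ → ℝ}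
    (h1 : ContDiff ℝ ∞ φ) (h3 : tsupport φ ⊆ Ioo 0 ℓ) :
    ∫ x in Ioo 0 ℓ, (a + ∫ t in (0 : ℝ)..x, g t) * deriv φ x = -∫ x in Ioo 0 ℓ, g x * φ x := by
  have hg := L2.intervalIntegrable hℓ.le g
  set F : ℝ → ℝ := fun x => a + ∫ t in (0 : ℝ)..x, g t with hF
  have hFac : AbsolutelyContinuousOnInterval F 0 ℓ := by
    have c : AbsolutelyContinuousOnInterval (fun _ : ℝ => a) 0 ℓ :=
      (LipschitzWith.const a).lipschitzOnWith.absolutelyContinuousOnInterval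
    exact c.add (hg.absolutelyContinuousOnInterval_intervalIntegral (by simp))
  have hφac : AbsolutelyContinuousOnInterval φ 0 ℓ :=
    ((h1.of_le (by simp)).contDiffOn).absolutelyContinuousOnInterval
  have z (x : ℝ) (hx : x ∉ Ioo 0 ℓ) : φ x = 0 :=
    image_eq_zero_of_notMem_tsupport (fun h' => hx (h3 h'))
  have key := hFac.integral_mul_deriv_eq_deriv_mul hφac
  rw [z 0 (by simp), z ℓ (by simp), mul_zero, mul_zero, sub_zero, zero_sub] at key
  rw [← integral_Ioc_eq_integral_Ioo, ← integral_Ioc_eq_integral_Ioo,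
    ← intervalIntegral.integral_of_le hℓ.le, ← intervalIntegral.integral_of_le hℓ.le, key]
  congr 1
  apply intervalIntegral.integral_congr_ae
  filter_upwards [hg.ae_hasDerivAt_integral] with x hx hx'
  have := (hx (uIoc_subset_uIcc hx') 0 (by simp)).const_add a
  rw [this.deriv]

/-- A function with vanishing weak derivative is constant. -/
theorem ae_const_of_test {ℓ : ℝ} (hℓ : 0 < ℓ) {f : ℝ → ℝ}
    (hf : IntegrableOn f (Ioo 0 ℓ) volume)
    (h : ∀ φ : ℝ → ℝ, ContDiff ℝ ∞ φ → HasCompactSupport φ → tsupport φ ⊆ Ioo 0 ℓ →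
      ∫ x in Ioo 0 ℓ, f x * deriv φ x = 0) :
    ∃ k : ℝ, ∀ᵐ x ∂(volume.restrict (Ioo 0 ℓ)), f x = k := by
  -- a bump function of integral one
  let b : ContDiffBump (ℓ / 2) := ⟨ℓ / 8, ℓ / 4, by positivity, by linarith⟩
  set ψ₀ : ℝ → ℝ := b.normed volume with hψ₀
  have p1 : ContDiff ℝ ∞ ψ₀ := b.contDiff_normed
  have p2 : HasCompactSupport ψ₀ := b.hasCompactSupport_normed
  have p3 : tsupport ψ₀ ⊆ Icc (ℓ / 4) (3 * ℓ / 4) := by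
    rw [hψ₀, b.tsupport_normed_eq, Real.closedBall_eq_Icc]
    apply Icc_subset_Icc <;> simp only [b] <;> linarith
  have p3' : tsupport ψ₀ ⊆ Ioo 0 ℓ := p3.trans (Icc_subset_Ioo (by linarith) (by linarith))
  have p4 : ∫ x, ψ₀ x = 1 := b.integral_normed
  refine ⟨∫ x in Ioo 0 ℓ, f x * ψ₀ x, ?_⟩
  set k := ∫ x in Ioo 0 ℓ, f x * ψ₀ x with hk
  suffices ∀ᵐ x ∂(volume.restrict (Ioo 0 ℓ)), f x - k = 0 by
    filter_upwards [this] with x hx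
    linarith
  have hkint : IntegrableOn (fun _ : ℝ => k) (Ioo 0 ℓ) volume := integrableOn_const (by simp)
  apply ae_zero_of_test (hf.sub hkint)
  intro ψ q1 q2 q3
  set s := ∫ x, ψ x with hs
  set η : ℝ → ℝ := fun x => ψ x - s * ψ₀ x with hη
  have hηc : Continuous η := q1.continuous.sub (continuous_const.mul p1.continuous)
  have hηd : ContDiff ℝ ∞ η := q1.sub (contDiff_const.mul p1)
  have hηs : HasCompactSupport η := q2.sub (p2.mul_left)
  have hη3 : tsupport η ⊆ Ioo 0 ℓ := by
    refine (tsupport_sub _ _).trans (union_subset q3 ?_)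
    exact (tsupport_mul_subset_right).trans p3'
  -- `η` is supported in a compact subinterval
  obtain ⟨α, β, hα, hαβ, hβ, hsub⟩ : ∃ α β : ℝ, 0 < α ∧ α ≤ β ∧ β < ℓ ∧ tsupport η ⊆ Icc α β := by
    rcases (tsupport η).eq_empty_or_nonempty with he | hne
    · exact ⟨ℓ / 2, ℓ / 2, by linarith, le_rfl, by linarith, by simp [he]⟩
    · have hcpt : IsCompact (tsupport η) := hηs
      have m1 := hcpt.sInf_mem hne
      have m2 := hcpt.sSup_mem hne
      refine ⟨sInf (tsupport η), sSup (tsupport η), (hη3 m1).1, ?_, (hη3 m2).2, ?_⟩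
      · exact csInf_le hcpt.bddBelow m2
      · intro x hx
        exact ⟨csInf_le hcpt.bddBelow hx, le_csSup hcpt.bddAbove hx⟩
  have hz (x : ℝ) (hx : x ∉ Icc α β) : η x = 0 :=
    image_eq_zero_of_notMem_tsupport (fun h' => hx (hsub h'))
  set Φ : ℝ → ℝ := fun x => ∫ t in (0 : ℝ)..x, η t with hΦ
  have hder (x : ℝ) : HasDerivAt Φ (η x) x :=
    intervalIntegral.integral_hasDerivAt_right (hηc.intervalIntegrable _ _)
      (hηc.stronglyMeasurableAtFilter _ _) hηc.continuousAt
  have hderiv : deriv Φ = η := funext fun x => (hder x).deriv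
  have hΦd : ContDiff ℝ ∞ Φ := by
    rw [contDiff_infty_iff_deriv, hderiv]
    exact ⟨fun x => (hder x).differentiableAt, hηd⟩
  have hint : ∫ x, η x = 0 := by
    rw [hη, integral_sub (q1.continuous.integrable_of_hasCompactSupport q2)
      ((p1.continuous.integrable_of_hasCompactSupport p2).const_mul s), integral_const_mul, p4]
    simp [hs]
  have hΦz (x : ℝ) (hx : x ∉ Icc α β) : Φ x = 0 := by
    rw [mem_Icc, not_and_or, not_le, not_le] at hx
    rcases hx with hx | hx
    · have : ∫ t in (0 : ℝ)..x, η t = ∫ t in (0 : ℝ)..x, (0 : ℝ) := by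
        apply intervalIntegral.integral_congr
        intro t ht
        apply hz
        rintro ⟨ht1, _⟩
        have := ht.2
        have : max 0 x < α := max_lt hα hx
        exact absurd (ht1.trans ht.2) (by simpa using this)
      simpa [hΦ] using this
    · have h0x : (0 : ℝ) ≤ x := by linarith
      have : ∫ t in Ioc 0 x, η t = ∫ t, η t := by
        apply setIntegral_eq_integral_of_forall_compl_eq_zero
        intro t ht
        apply hz
        rintro ⟨ht1, ht2⟩
        exact ht ⟨by linarith, by linarith⟩
      simp only [hΦ]
      rw [intervalIntegral.integral_of_le h0x, this, hint]
  have hΦts : tsupport Φ ⊆ Icc α β := by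
    apply closure_minimal _ isClosed_Icc
    intro x hx
    by_contra hc
    exact hx (hΦz x hc)
  have hΦc : HasCompactSupport Φ := HasCompactSupport.of_support_subset_isCompact isCompact_Icc
    ((subset_tsupport _).trans hΦts)
  have fin := h Φ hΦd hΦc (hΦts.trans (Icc_subset_Ioo hα hβ))
  rw [hderiv] at fin
  have e1 : ∫ x in Ioo 0 ℓ, f x * η x
      = (∫ x in Ioo 0 ℓ, f x * ψ x) - s * k := by
    rw [hk, ← integral_const_mul, ← integral_sub (integrable_mul_test hf q1.continuous q2)
      ((integrable_mul_test hf p1.continuous p2).const_mul s)]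
    congr 1
    ext x
    simp only [hη]
    ring
  have e2 : ∫ x in Ioo 0 ℓ, k * ψ x = s * k := by
    rw [setIntegral_test q3, integral_mul_const]
  change ∫ x in Ioo 0 ℓ, (f x - k) * ψ x = 0
  simp only [sub_mul]
  rw [integral_sub (integrable_mul_test hf q1.continuous q2)
    (integrable_mul_test hkint q1.continuous q2), e2]
  linarith

/-- Weak differentiability in terms of primitives. -/
theorem hasWeakDeriv_iff {ℓ : ℝ} (hℓ : 0 < ℓ) {f g : L2 ℓ} :
    HasWeakDeriv f g ↔
      ∃ a : ℝ, ∀ᵐ x ∂(volume.restrict (Ioo 0 ℓ)), f x = a + ∫ t in (0 : ℝ)..x, g t := by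
  constructor
  · intro h
    have hg := L2.intervalIntegrable hℓ.le g
    have hc : ContinuousOn (fun x => ∫ t in (0 : ℝ)..x, g t) (Icc 0 ℓ) := by
      have := (hg.absolutelyContinuousOnInterval_intervalIntegral (c := 0)
        (by simp)).continuousOn
      rwa [uIcc_of_le hℓ.le] at this
    have hci : IntegrableOn (fun x => ∫ t in (0 : ℝ)..x, g t) (Ioo 0 ℓ) volume :=
      (hc.integrableOn_Icc).mono_set Ioo_subset_Icc_self
    obtain ⟨k, hk⟩ := ae_const_of_test hℓ (f := fun x => f x - ∫ t in (0 : ℝ)..x, g t)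
      (f.integrable.sub hci) (by
        intro φ a b c
        have d : Continuous (deriv φ) := a.continuous_deriv (by simp)
        have := integral_primitive_mul_deriv hℓ 0 g a c
        simp only [zero_add] at this
        simp only [sub_mul]
        rw [integral_sub (integrable_mul_test (L2.integrable f) d b.deriv)
          (integrable_mul_test hci d b.deriv), h φ a b c, this, sub_self])
    refine ⟨k, ?_⟩
    filter_upwards [hk] with x hx
    linarith
  · rintro ⟨a, ha⟩ φ h1 h2 h3
    rw [← integral_primitive_mul_deriv hℓ a g h1 h3]
    apply integral_congr_ae
    filter_upwards [ha] with x hx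
    rw [hx]


theorem ae_Ioc_of_ae_Ioo {ℓ : ℝ} {P : ℝ → Prop}
    (h : ∀ᵐ x ∂(volume.restrict (Ioo 0 ℓ)), P x) : ∀ᵐ x, x ∈ Ioc 0 ℓ → P x := by
  rw [Measure.restrict_congr_set Ioo_ae_eq_Ioc] at h
  exact (ae_restrict_iff' measurableSet_Ioc).1 h

/-- The Sobolev space `H¹(0, ℓ)`. -/
def H1 (ℓ : ℝ) : Submodule ℝ (L2 ℓ) where
  carrier := {f | ∃ g : L2 ℓ, HasWeakDeriv f g}
  add_mem' := fun ⟨g₁, h₁⟩ ⟨g₂, h₂⟩ => ⟨g₁ + g₂, h₁.add h₂⟩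
  zero_mem' := ⟨0, HasWeakDeriv.zero⟩
  smul_mem' := fun r _ ⟨g, h⟩ => ⟨r • g, h.smul r⟩

/-- The weak derivative `H¹(0, ℓ) → L²(0, ℓ)`. -/
def weakDeriv (ℓ : ℝ) : H1 ℓ →ₗ[ℝ] L2 ℓ where
  toFun f := f.2.choose
  map_add' f g := (f + g).2.choose_spec.unique (f.2.choose_spec.add g.2.choose_spec)
  map_smul' r f := (r • f).2.choose_spec.unique (f.2.choose_spec.smul r)

theorem hasWeakDeriv_weakDeriv {ℓ : ℝ} (f : H1 ℓ) : HasWeakDeriv (f : L2 ℓ) (weakDeriv ℓ f) :=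
  f.2.choose_spec

/-- The Sobolev space `H²(0, ℓ)`. -/
def H2 (ℓ : ℝ) : Submodule ℝ (L2 ℓ) := ((H1 ℓ).comap (weakDeriv ℓ)).map (H1 ℓ).subtype

theorem continuousOn_primitive {ℓ : ℝ} (hℓ : 0 < ℓ) (g : L2 ℓ) :
    ContinuousOn (fun x => ∫ t in (0 : ℝ)..x, g t) (Icc 0 ℓ) := by
  have := ((L2.intervalIntegrable hℓ.le g).absolutelyContinuousOnInterval_intervalIntegral (c := 0)
    (by simp)).continuousOn
  rwa [uIcc_of_le hℓ.le] at this

theorem IccExtend_eqOn {ℓ : ℝ} (hℓ : 0 < ℓ) (F : C(Icc (0 : ℝ) ℓ, ℝ)) {x : ℝ}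
    (hx : x ∈ Icc 0 ℓ) : IccExtend hℓ.le F x = F ⟨x, hx⟩ :=
  IccExtend_of_mem _ _ hx

theorem exists_contRep {ℓ : ℝ} (hℓ : 0 < ℓ) (f : H1 ℓ) : ∃ F : C(Icc (0 : ℝ) ℓ, ℝ),
    ((f : L2 ℓ) : ℝ → ℝ) =ᵐ[volume.restrict (Ioo 0 ℓ)] IccExtend hℓ.le F := by
  obtain ⟨a, ha⟩ := (hasWeakDeriv_iff hℓ).1 (hasWeakDeriv_weakDeriv f)
  have hc : ContinuousOn (fun x => a + ∫ t in (0 : ℝ)..x, weakDeriv ℓ f t) (Icc 0 ℓ) :=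
    continuousOn_const.add (continuousOn_primitive hℓ _)
  refine ⟨⟨_, continuousOn_iff_continuous_domRestrict.1 hc⟩, ?_⟩
  filter_upwards [ha, ae_restrict_mem measurableSet_Ioo] with x hx hx'
  rw [IccExtend_eqOn hℓ _ (Ioo_subset_Icc_self hx'), hx]
  rfl

theorem contRep_unique {ℓ : ℝ} (hℓ : 0 < ℓ) {F G : C(Icc (0 : ℝ) ℓ, ℝ)}
    (h : IccExtend hℓ.le F =ᵐ[volume.restrict (Ioo 0 ℓ)] IccExtend hℓ.le G) : F = G := by
  rw [Measure.restrict_congr_set Ioo_ae_eq_Icc] at h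
  have := Measure.eqOn_Icc_of_ae_eq volume hℓ.ne h
    (F.continuous.Icc_extend').continuousOn (G.continuous.Icc_extend').continuousOn
  ext x
  have e := this x.2
  rwa [IccExtend_eqOn hℓ _ x.2, IccExtend_eqOn hℓ _ x.2] at e

/-- The continuous representative on `[0, ℓ]` of a function in `H¹(0, ℓ)`. -/
def contRep {ℓ : ℝ} (hℓ : 0 < ℓ) : H1 ℓ →ₗ[ℝ] C(Icc (0 : ℝ) ℓ, ℝ) where
  toFun f := (exists_contRep hℓ f).choose
  map_add' f g := by
    apply contRep_unique hℓ
    have h1 := (exists_contRep hℓ f).choose_spec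
    have h2 := (exists_contRep hℓ g).choose_spec
    have h3 := (exists_contRep hℓ (f + g)).choose_spec
    filter_upwards [h1, h2, h3, Lp.coeFn_add (f : L2 ℓ) (g : L2 ℓ)] with x e1 e2 e3 e4
    rw [← e3, Submodule.coe_add, e4, Pi.add_apply, e1, e2]
    rfl
  map_smul' r f := by
    apply contRep_unique hℓ
    have h1 := (exists_contRep hℓ f).choose_spec
    have h3 := (exists_contRep hℓ (r • f)).choose_spec
    filter_upwards [h1, h3, Lp.coeFn_smul r (f : L2 ℓ)] with x e1 e3 e4
    rw [← e3, Submodule.coe_smul, e4, Pi.smul_apply, e1]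
    rfl

theorem contRep_ae_eq {ℓ : ℝ} (hℓ : 0 < ℓ) (f : H1 ℓ) :
    ((f : L2 ℓ) : ℝ → ℝ) =ᵐ[volume.restrict (Ioo 0 ℓ)] IccExtend hℓ.le (contRep hℓ f) :=
  (exists_contRep hℓ f).choose_spec

theorem contRep_eq_primitive {ℓ : ℝ} (hℓ : 0 < ℓ) (f : H1 ℓ) : ∃ a : ℝ, ∀ x : Icc (0 : ℝ) ℓ,
    contRep hℓ f x = a + ∫ t in (0 : ℝ)..x, weakDeriv ℓ f t := by
  obtain ⟨a, ha⟩ := (hasWeakDeriv_iff hℓ).1 (hasWeakDeriv_weakDeriv f)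
  have hc : ContinuousOn (fun x => a + ∫ t in (0 : ℝ)..x, weakDeriv ℓ f t) (Icc 0 ℓ) :=
    continuousOn_const.add (continuousOn_primitive hℓ _)
  refine ⟨a, fun x => ?_⟩
  have : contRep hℓ f = ⟨_, continuousOn_iff_continuous_domRestrict.1 hc⟩ := by
    apply contRep_unique hℓ
    filter_upwards [ha, contRep_ae_eq hℓ f, ae_restrict_mem measurableSet_Ioo] with x h1 h2 h3
    rw [← h2, IccExtend_eqOn hℓ _ (Ioo_subset_Icc_self h3), h1]
    rfl
  rw [this]
  rfl

/-- Multiplication of an `L²` function by a fixed `L^∞` function. -/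
def mulBdd {ℓ : ℝ} (a : Lp ℝ ∞ (volume.restrict (Ioo (0 : ℝ) ℓ))) : L2 ℓ →ₗ[ℝ] L2 ℓ where
  toFun f := (a • f : Lp ℝ 2 (volume.restrict (Ioo (0 : ℝ) ℓ)))
  map_add' f g := Lp.add_smul a f g
  map_smul' r f := (Lp.smul_comm r a f).symm

theorem mulBdd_ae_eq {ℓ : ℝ} (a : Lp ℝ ∞ (volume.restrict (Ioo (0 : ℝ) ℓ))) (f : L2 ℓ) :
    ∀ᵐ x ∂(volume.restrict (Ioo 0 ℓ)), mulBdd a f x = a x * f x :=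
  Lp.coeFn_lpSMul a f

theorem memLp_IccExtend {ℓ : ℝ} (hℓ : 0 < ℓ) (c : C(Icc (0 : ℝ) ℓ, ℝ)) :
    MemLp (IccExtend hℓ.le c) ∞ (volume.restrict (Ioo (0 : ℝ) ℓ)) := by
  refine memLp_top_of_bound c.continuous.Icc_extend'.aestronglyMeasurable ‖c‖ (ae_of_all _ ?_)
  intro x
  exact c.norm_coe_le_norm _

/-- A continuous function on `[0, ℓ]` as an element of `L^∞(0, ℓ)`. -/
def contToLinf {ℓ : ℝ} (hℓ : 0 < ℓ) (c : C(Icc (0 : ℝ) ℓ, ℝ)) :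
    Lp ℝ ∞ (volume.restrict (Ioo (0 : ℝ) ℓ)) := (memLp_IccExtend hℓ c).toLp

theorem contToLinf_ae_eq {ℓ : ℝ} (hℓ : 0 < ℓ) (c : C(Icc (0 : ℝ) ℓ, ℝ)) :
    (contToLinf hℓ c : ℝ → ℝ) =ᵐ[volume.restrict (Ioo 0 ℓ)] IccExtend hℓ.le c :=
  (memLp_IccExtend hℓ c).coeFn_toLp

/-- The maximal domain in `L²(0, ℓ)` of `u ↦ (c u')'`:
all `u ∈ H¹(0, ℓ)` with `c u' ∈ H¹(0, ℓ)`. -/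
def edgeDomain {ℓ : ℝ} (hℓ : 0 < ℓ) (c : C(Icc (0 : ℝ) ℓ, ℝ)) : Submodule ℝ (L2 ℓ) :=
  ((H1 ℓ).comap (mulBdd (contToLinf hℓ c) ∘ₗ weakDeriv ℓ)).map (H1 ℓ).subtype

theorem mem_edgeDomain {ℓ : ℝ} {hℓ : 0 < ℓ} {c : C(Icc (0 : ℝ) ℓ, ℝ)} {f : L2 ℓ} :
    f ∈ edgeDomain hℓ c ↔
      ∃ hf : f ∈ H1 ℓ, mulBdd (contToLinf hℓ c) (weakDeriv ℓ ⟨f, hf⟩) ∈ H1 ℓ := by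
  constructor
  · rintro ⟨g, hg, rfl⟩
    exact ⟨g.2, hg⟩
  · rintro ⟨hf, h⟩
    exact ⟨⟨f, hf⟩, h, rfl⟩

theorem edgeDomain_le {ℓ : ℝ} (hℓ : 0 < ℓ) (c : C(Icc (0 : ℝ) ℓ, ℝ)) :
    edgeDomain hℓ c ≤ H1 ℓ := fun _ h => (mem_edgeDomain.1 h).1

/-- The flux `u ↦ c u'`, as a map from the maximal domain to `H¹(0, ℓ)`. -/
def edgeFlux {ℓ : ℝ} (hℓ : 0 < ℓ) (c : C(Icc (0 : ℝ) ℓ, ℝ)) : edgeDomain hℓ c →ₗ[ℝ] H1 ℓ :=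
  (mulBdd (contToLinf hℓ c) ∘ₗ weakDeriv ℓ ∘ₗ Submodule.inclusion (edgeDomain_le hℓ c)).codRestrict
    (H1 ℓ) fun f => (mem_edgeDomain.1 f.2).2

/-- The operator `u ↦ (c u')' - p u` on one edge. -/
def edgeOp {ℓ : ℝ} (hℓ : 0 < ℓ) (c : C(Icc (0 : ℝ) ℓ, ℝ))
    (p : Lp ℝ ∞ (volume.restrict (Ioo (0 : ℝ) ℓ))) : edgeDomain hℓ c →ₗ[ℝ] L2 ℓ :=
  weakDeriv ℓ ∘ₗ edgeFlux hℓ c - mulBdd p ∘ₗ (edgeDomain hℓ c).subtype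

/-- The value at `x ∈ [0, ℓ]` of `u`, for `u` in the maximal domain. -/
def edgeVal {ℓ : ℝ} (hℓ : 0 < ℓ) (c : C(Icc (0 : ℝ) ℓ, ℝ)) (x : Icc (0 : ℝ) ℓ) :
    edgeDomain hℓ c →ₗ[ℝ] ℝ where
  toFun u := contRep hℓ (Submodule.inclusion (edgeDomain_le hℓ c) u) x
  map_add' u v := by simp
  map_smul' r u := by simp

/-- The value at `x ∈ [0, ℓ]` of the derivative `u'`, for `u` in the maximal domain: since
`c u' ∈ H¹(0, ℓ)` and `c` is continuous and positive, `u'` has the continuous representative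
`(c u') / c` (this is the classical derivative, see `hasDerivWithinAt_edgeVal`). -/
def edgeDeriv {ℓ : ℝ} (hℓ : 0 < ℓ) (c : C(Icc (0 : ℝ) ℓ, ℝ)) (x : Icc (0 : ℝ) ℓ) :
    edgeDomain hℓ c →ₗ[ℝ] ℝ where
  toFun u := contRep hℓ (edgeFlux hℓ c u) x / c x
  map_add' u v := by simp [add_div]
  map_smul' r u := by simp [mul_div_assoc]

/-- `edgeDeriv` is the classical derivative (one-sided at the end points) of the continuous
representative. -/
theorem hasDerivWithinAt_edgeVal {ℓ : ℝ} (hℓ : 0 < ℓ) (c : C(Icc (0 : ℝ) ℓ, ℝ))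
    (hc : ∀ x, 0 < c x) (u : edgeDomain hℓ c) (x : Icc (0 : ℝ) ℓ) :
    HasDerivWithinAt (IccExtend hℓ.le fun y => edgeVal hℓ c y u) (edgeDeriv hℓ c x u)
      (Icc 0 ℓ) x := by
  set u₁ := Submodule.inclusion (edgeDomain_le hℓ c) u with hu₁
  obtain ⟨a, ha⟩ := contRep_eq_primitive hℓ u₁
  let q : C(Icc (0 : ℝ) ℓ, ℝ) := ⟨fun y => edgeDeriv hℓ c y u,
    (contRep hℓ (edgeFlux hℓ c u)).continuous.div c.continuous fun y => (hc y).ne'⟩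
  have hq : Continuous (IccExtend hℓ.le q) := q.continuous.Icc_extend'
  have hae : ∀ᵐ y ∂(volume.restrict (Ioo 0 ℓ)), weakDeriv ℓ u₁ y = IccExtend hℓ.le q y := by
    filter_upwards [contRep_ae_eq hℓ (edgeFlux hℓ c u), contToLinf_ae_eq hℓ c,
      mulBdd_ae_eq (contToLinf hℓ c) (weakDeriv ℓ u₁),
      ae_restrict_mem measurableSet_Ioo] with y h1 h2 h3 h4
    have h5 := Ioo_subset_Icc_self h4
    rw [IccExtend_eqOn hℓ _ h5] at h1 h2 ⊢
    change mulBdd (contToLinf hℓ c) (weakDeriv ℓ u₁) y = _ at h1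
    rw [h3, h2] at h1
    change _ = contRep hℓ (edgeFlux hℓ c u) ⟨y, h5⟩ / c ⟨y, h5⟩
    rw [← h1, mul_div_cancel_left₀ _ (hc _).ne']
  have hder : HasDerivAt (fun z => a + ∫ t in (0 : ℝ)..z, IccExtend hℓ.le q t)
      (IccExtend hℓ.le q x) x :=
    (intervalIntegral.integral_hasDerivAt_right (hq.intervalIntegrable _ _)
      (hq.stronglyMeasurableAtFilter _ _) hq.continuousAt).const_add a
  have e0 : IccExtend hℓ.le q x = edgeDeriv hℓ c x u := IccExtend_val _ _ _
  rw [e0] at hder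
  have hval : ∀ z ∈ Icc 0 ℓ, IccExtend hℓ.le (fun y => edgeVal hℓ c y u) z
      = a + ∫ t in (0 : ℝ)..z, IccExtend hℓ.le q t := by
    intro z hz
    rw [IccExtend_of_mem _ _ hz]
    change contRep hℓ u₁ ⟨z, hz⟩ = _
    rw [ha]
    congr 1
    apply intervalIntegral.integral_congr_ae
    filter_upwards [ae_Ioc_of_ae_Ioo hae] with t ht ht'
    rw [uIoc_of_le hz.1] at ht'
    exact ht ⟨ht'.1, ht'.2.trans hz.2⟩
  exact hder.hasDerivWithinAt.congr hval (hval _ x.2)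

theorem mulBdd_mem_H1 {ℓ : ℝ} (hℓ : 0 < ℓ) (b : C(Icc (0 : ℝ) ℓ, ℝ)) {K : ℝ≥0}
    (hb : LipschitzWith K b) (g : H1 ℓ) : mulBdd (contToLinf hℓ b) g ∈ H1 ℓ := by
  obtain ⟨a, ha⟩ := (hasWeakDeriv_iff hℓ).1 (hasWeakDeriv_weakDeriv g)
  set g' := weakDeriv ℓ g with hg'
  have hgi := L2.intervalIntegrable hℓ.le g'
  set G : ℝ → ℝ := fun x => a + ∫ t in (0 : ℝ)..x, g' t with hG
  have hGac : AbsolutelyContinuousOnInterval G 0 ℓ := by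
    have c : AbsolutelyContinuousOnInterval (fun _ : ℝ => a) 0 ℓ :=
      (LipschitzWith.const a).lipschitzOnWith.absolutelyContinuousOnInterval
    exact c.add (hgi.absolutelyContinuousOnInterval_intervalIntegral (by simp))
  set β : ℝ → ℝ := IccExtend hℓ.le b with hβ
  have hβl : LipschitzWith K β := by
    have := hb.comp (LipschitzWith.projIcc hℓ.le)
    rwa [mul_one] at this
  have hβac : AbsolutelyContinuousOnInterval β 0 ℓ :=
    hβl.lipschitzOnWith.absolutelyContinuousOnInterval
  have hPac := hβac.fun_mul hGac
  have hd : ∀ᵐ x ∂(volume.restrict (Ioo 0 ℓ)),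
      deriv (fun x => β x * G x) x = deriv β x * G x + β x * g' x := by
    rw [ae_restrict_iff' measurableSet_Ioo]
    filter_upwards [hβac.ae_differentiableAt, hgi.ae_hasDerivAt_integral] with x h1 h2 h3
    have h4 : x ∈ uIcc 0 ℓ := by
      rw [uIcc_of_le hℓ.le]
      exact Ioo_subset_Icc_self h3
    exact ((h1 h4).hasDerivAt.mul ((h2 h4 0 (by simp)).const_add a)).deriv
  have hL : MemLp (deriv fun x => β x * G x) 2 (volume.restrict (Ioo 0 ℓ)) := by
    rw [memLp_congr_ae hd]
    have hG2 : MemLp G 2 (volume.restrict (Ioo 0 ℓ)) :=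
      (memLp_congr_ae ha).1 (Lp.memLp (g : L2 ℓ))
    have hβ' : MemLp (deriv β) ∞ (volume.restrict (Ioo 0 ℓ)) :=
      memLp_top_of_bound (measurable_deriv β).aestronglyMeasurable K
        (ae_of_all _ fun x => norm_deriv_le_of_lipschitz hβl)
    exact (hG2.mul hβ').add ((Lp.memLp g').mul (memLp_IccExtend hℓ b))
  refine ⟨hL.toLp, (hasWeakDeriv_iff hℓ).2 ⟨β 0 * G 0, ?_⟩⟩
  filter_upwards [mulBdd_ae_eq (contToLinf hℓ b) g, contToLinf_ae_eq hℓ b, ha,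
    ae_restrict_mem measurableSet_Ioo] with x h1 h2 h3 h4
  rw [h1, h2, h3]
  have hx : x ∈ Icc 0 ℓ := Ioo_subset_Icc_self h4
  have hsub : uIcc 0 x ⊆ uIcc 0 ℓ := by
    rw [uIcc_of_le hx.1, uIcc_of_le hℓ.le]
    exact Icc_subset_Icc_right hx.2
  have e1 := (hPac.mono hsub).integral_deriv_eq_sub
  have e2 : ∫ t in (0 : ℝ)..x, (hL.toLp _ : ℝ → ℝ) t = ∫ t in (0 : ℝ)..x, deriv (fun x => β x * G x) t := by
    apply intervalIntegral.integral_congr_ae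
    filter_upwards [ae_Ioc_of_ae_Ioo hL.coeFn_toLp] with t ht ht'
    rw [uIoc_of_le hx.1] at ht'
    exact ht ⟨ht'.1, ht'.2.trans hx.2⟩
  rw [e2, e1]
  change β x * G x = _
  ring

/-- For a Lipschitz coefficient the maximal domain of `u ↦ (c u')'` is `H²(0, ℓ)`. -/
theorem edgeDomain_eq_H2 {ℓ : ℝ} (hℓ : 0 < ℓ) (c : C(Icc (0 : ℝ) ℓ, ℝ)) {K : ℝ≥0}
    (hK : LipschitzWith K c) (hc : ∀ x, 0 < c x) : edgeDomain hℓ c = H2 ℓ := by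
  obtain ⟨x₀, -, hx₀⟩ := isCompact_univ.exists_isMinOn
    (⟨⟨0, le_rfl, hℓ.le⟩, mem_univ _⟩ : (univ : Set (Icc (0 : ℝ) ℓ)).Nonempty)
    c.continuous.continuousOn
  let ci : C(Icc (0 : ℝ) ℓ, ℝ) := ⟨fun x => (c x)⁻¹, c.continuous.inv₀ fun x => (hc x).ne'⟩
  set m := c x₀ with hm
  have hm0 : 0 < m := hc x₀
  have hmin (x) : m ≤ c x := hx₀ (mem_univ x)
  have hci : LipschitzWith (K * (Real.toNNReal (m * m)⁻¹)) ci := by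
    apply LipschitzWith.of_dist_le_mul
    intro x y
    have h1 := hK.dist_le_mul x y
    change |(c x)⁻¹ - (c y)⁻¹| ≤ _
    rw [inv_sub_inv (hc x).ne' (hc y).ne', abs_div, abs_of_pos (mul_pos (hc x) (hc y)),
      NNReal.coe_mul, Real.coe_toNNReal _ (by positivity), abs_sub_comm]
    rw [Real.dist_eq] at h1
    calc |c x - c y| / (c x * c y) ≤ (K * dist x y) / (m * m) := by
          have hmm : m * m ≤ c x * c y := mul_le_mul (hmin x) (hmin y) hm0.le (hc x).le
          gcongr
      _ = _ := by rw [div_eq_mul_inv]; ring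
  ext f
  constructor
  · intro h
    obtain ⟨hf, hw⟩ := mem_edgeDomain.1 h
    refine ⟨⟨f, hf⟩, ?_, rfl⟩
    have := mulBdd_mem_H1 hℓ ci hci ⟨_, hw⟩
    have e : mulBdd (contToLinf hℓ ci) (mulBdd (contToLinf hℓ c) (weakDeriv ℓ ⟨f, hf⟩))
        = weakDeriv ℓ ⟨f, hf⟩ := by
      apply Lp.ext
      filter_upwards [mulBdd_ae_eq (contToLinf hℓ ci)
        (mulBdd (contToLinf hℓ c) (weakDeriv ℓ ⟨f, hf⟩)),
        mulBdd_ae_eq (contToLinf hℓ c) (weakDeriv ℓ ⟨f, hf⟩), contToLinf_ae_eq hℓ ci,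
        contToLinf_ae_eq hℓ c, ae_restrict_mem measurableSet_Ioo] with x h1 h2 h3 h4 h5
      have h6 := Ioo_subset_Icc_self h5
      rw [IccExtend_eqOn hℓ _ h6] at h3 h4
      rw [h1, h2, h3, h4]
      exact inv_mul_cancel_left₀ (hc _).ne' _
    change mulBdd (contToLinf hℓ ci) (mulBdd (contToLinf hℓ c) (weakDeriv ℓ ⟨f, hf⟩)) ∈ H1 ℓ at this
    rwa [e] at this
  · rintro ⟨g, hg, rfl⟩
    exact mem_edgeDomain.2 ⟨g.2, mulBdd_mem_H1 hℓ c hK ⟨_, hg⟩⟩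

/-- A finite simple metric graph with the coefficients of the operator `u ↦ (c u')' - p u`.
Each edge `e` is parametrized by `[0, length e]` from `src e` to `tgt e`, and at each vertex
the incident edges are enumerated. Parametrizations and enumerations are arbitrary. -/
structure QuantumGraph (V : Type*) [Fintype V] [DecidableEq V] where
  graph : SimpleGraph V
  decAdj : DecidableRel graph.Adj
  src : graph.edgeSet → V
  tgt : graph.edgeSet → V
  ends : ∀ e, s(src e, tgt e) = (e : Sym2 V)
  length : graph.edgeSet → ℝ
  length_pos : ∀ e, 0 < length e
  cond : ∀ e, C(Icc (0 : ℝ) (length e), ℝ)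
  cond_bound : ∃ c₀ > 0, ∀ e, ∀ᵐ x ∂(volume.restrict (Ioo 0 (length e))),
    c₀ ≤ IccExtend (length_pos e).le (cond e) x
  pot : ∀ e, Lp ℝ ∞ (volume.restrict (Ioo (0 : ℝ) (length e)))
  pot_nonneg : ∀ e, ∀ᵐ x ∂(volume.restrict (Ioo 0 (length e))), 0 ≤ pot e x
  enum : ∀ v, Fin (graph.degree v) ≃ {e : graph.edgeSet // v ∈ (e : Sym2 V)}

attribute [instance] QuantumGraph.decAdj

namespace QuantumGraph

variable {V : Type*} [Fintype V] [DecidableEq V] (Γ : QuantumGraph V)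

theorem cond_pos (e : Γ.graph.edgeSet) (x : Icc (0 : ℝ) (Γ.length e)) : 0 < Γ.cond e x := by
  obtain ⟨c₀, h0, h⟩ := Γ.cond_bound
  have hℓ := Γ.length_pos e
  let F : C(Icc (0 : ℝ) (Γ.length e), ℝ) := ⟨fun y => max c₀ (Γ.cond e y), by fun_prop⟩
  have : F = Γ.cond e := by
    apply contRep_unique hℓ
    filter_upwards [h e] with y hy
    exact max_eq_right hy
  rw [← this]
  exact lt_max_of_lt_left h0

/-- The state space: the Hilbert direct sum of the `L²` spaces of the edges. -/
abbrev H : Type _ := PiLp 2 fun e : Γ.graph.edgeSet => L2 (Γ.length e)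

/-- The boundary space `ℝ^{2m}`: at each vertex `v` there are `deg v - 1` coordinates for the
continuity conditions and one for the Kirchhoff condition. -/
abbrev Y : Type _ := EuclideanSpace ℝ ((Σ v : V, Fin (Γ.graph.degree v - 1)) ⊕ V)

/-- The boundary space `ℝ^n` of the Kirchhoff conditions. -/
abbrev YK (_Γ : QuantumGraph V) : Type _ := EuclideanSpace ℝ V

/-- The boundary space has dimension `2m` if there are no isolated vertices. -/
theorem finrank_Y (hdeg : ∀ v, 0 < Γ.graph.degree v) :
    Module.finrank ℝ Γ.Y = 2 * Fintype.card Γ.graph.edgeSet := by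
  rw [finrank_euclideanSpace, Fintype.card_sum, Fintype.card_sigma]
  have h := Γ.graph.sum_degrees_eq_twice_card_edges
  rw [SimpleGraph.edgeFinset_card] at h
  rw [← h, ← Finset.card_univ, Finset.card_eq_sum_ones, ← Finset.sum_add_distrib]
  refine Finset.sum_congr rfl fun v _ => ?_
  rw [Fintype.card_fin]
  exact Nat.sub_add_cancel (hdeg v)

/-- The maximal domain: all `u` with `u_e ∈ H¹` and `c_e u_e' ∈ H¹` on every edge `e`. -/
def maxDomain : Submodule ℝ Γ.H where
  carrier := {u | ∀ e, u e ∈ edgeDomain (Γ.length_pos e) (Γ.cond e)}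
  add_mem' := fun hu hv e => Submodule.add_mem _ (hu e) (hv e)
  zero_mem' := fun _ => Submodule.zero_mem _
  smul_mem' := fun r _ hu e => Submodule.smul_mem _ r (hu e)

/-- The component on the edge `e` of an element of the maximal domain. -/
def comp (e : Γ.graph.edgeSet) :
    Γ.maxDomain →ₗ[ℝ] edgeDomain (Γ.length_pos e) (Γ.cond e) where
  toFun u := ⟨(u : Γ.H) e, u.2 e⟩
  map_add' _ _ := rfl
  map_smul' _ _ := rfl

/-- `A_max`: the operator `u ↦ ((c_e u_e')' - p_e u_e)_e` on its maximal domain. -/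
def Amax : Γ.H →ₗ.[ℝ] Γ.H where
  domain := Γ.maxDomain
  toFun := (WithLp.linearEquiv 2 ℝ (∀ e, L2 (Γ.length e))).symm.toLinearMap ∘ₗ
    LinearMap.pi fun e => edgeOp (Γ.length_pos e) (Γ.cond e) (Γ.pot e) ∘ₗ Γ.comp e

/-- For Lipschitz coefficients, the domain of `A_max` is the product of the spaces `H²`. -/
theorem mem_Amax_domain_iff {K : ℝ≥0} (hK : ∀ e, LipschitzWith K (Γ.cond e)) (u : Γ.H) :
    u ∈ Γ.Amax.domain ↔ ∀ e, u e ∈ H2 (Γ.length e) :=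
  forall_congr' fun e => by
    rw [edgeDomain_eq_H2 (Γ.length_pos e) (Γ.cond e) (hK e) (Γ.cond_pos e)]

/-- The parameter in `[0, length e]` of the end point `v` of the edge `e`. -/
def endpoint (v : V) (e : Γ.graph.edgeSet) : Icc (0 : ℝ) (Γ.length e) :=
  if Γ.src e = v then ⟨0, le_rfl, (Γ.length_pos e).le⟩
  else ⟨Γ.length e, (Γ.length_pos e).le, le_rfl⟩

/-- The sign that turns the derivative in the direction of the parametrization into the
derivative in the direction away from the vertex `v`. -/
def outward (v : V) (e : Γ.graph.edgeSet) : ℝ := if Γ.src e = v then 1 else -1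

/-- The vector `U(v)` of the values of `u` in `v` along the edges incident to `v`. -/
def vertexVal (v : V) : Γ.Amax.domain →ₗ[ℝ] (Fin (Γ.graph.degree v) → ℝ) :=
  LinearMap.pi fun i =>
    edgeVal (Γ.length_pos (Γ.enum v i)) (Γ.cond (Γ.enum v i)) (Γ.endpoint v (Γ.enum v i)) ∘ₗ
      Γ.comp (Γ.enum v i)

/-- The vector `U'(v)` of the derivatives of `u` in `v` along the edges incident to `v`,
taken in the directions away from `v`. -/
def vertexDeriv (v : V) : Γ.Amax.domain →ₗ[ℝ] (Fin (Γ.graph.degree v) → ℝ) :=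
  LinearMap.pi fun i => Γ.outward v (Γ.enum v i) •
    (edgeDeriv (Γ.length_pos (Γ.enum v i)) (Γ.cond (Γ.enum v i)) (Γ.endpoint v (Γ.enum v i)) ∘ₗ
      Γ.comp (Γ.enum v i))

/-- The bi-diagonal matrix with entries `1, -1`. -/
def contMatrix (d : ℕ) : Matrix (Fin (d - 1)) (Fin d) ℝ :=
  Matrix.of fun i j => if j.val = i.val then 1 else if j.val = i.val + 1 then -1 else 0

/-- The row `C(v)ᵀ` of the values in `v` of the conductances of the incident edges. -/
def condRow (v : V) : Fin (Γ.graph.degree v) → ℝ := fun i =>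
  Γ.cond (Γ.enum v i) (Γ.endpoint v (Γ.enum v i))

/-- `u ↦ (I_v U(v))_v`. -/
def contOp : Γ.Amax.domain →ₗ[ℝ] ((Σ v : V, Fin (Γ.graph.degree v - 1)) → ℝ) :=
  LinearMap.pi fun i => LinearMap.proj i.2 ∘ₗ
    (contMatrix (Γ.graph.degree i.1)).mulVecLin ∘ₗ Γ.vertexVal i.1

/-- `u ↦ (C(v)ᵀ U'(v))_v`. -/
def kirchhoffOp : Γ.Amax.domain →ₗ[ℝ] (V → ℝ) where
  toFun u v := Γ.condRow v ⬝ᵥ Γ.vertexDeriv v u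
  map_add' u w := by
    ext v
    simp
  map_smul' r u := by
    ext v
    simp

/-- The boundary operator `B : D(A_max) → ℝ^{2m}`. -/
def B : Γ.Amax.domain →ₗ[ℝ] Γ.Y where
  toFun u := WithLp.toLp 2 (Sum.elim (Γ.contOp u) (Γ.kirchhoffOp u))
  map_add' u w := by
    ext i
    rcases i with i | i <;> simp
  map_smul' r u := by
    ext i
    rcases i with i | i <;> simp

/-- The operator `A`: the restriction of `A_max` to the kernel of `B`. -/
def A : Γ.H →ₗ.[ℝ] Γ.H :=
  Γ.Amax.domRestrict ((LinearMap.ker Γ.B).map Γ.Amax.domain.subtype)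

/-- `A_{K,max}`: the restriction of `A_max` to the functions that are continuous on the graph. -/
def AKmax : Γ.H →ₗ.[ℝ] Γ.H :=
  Γ.Amax.domRestrict ((LinearMap.ker Γ.contOp).map Γ.Amax.domain.subtype)

/-- The Kirchhoff boundary operator `B_K : D(A_{K,max}) → ℝ^n`. -/
def BK : Γ.AKmax.domain →ₗ[ℝ] Γ.YK :=
  (WithLp.linearEquiv 2 ℝ (V → ℝ)).symm.toLinearMap ∘ₗ Γ.kirchhoffOp ∘ₗ
    Submodule.inclusion inf_le_right

/-- The restriction of `A_{K,max}` to the kernel of `B_K`. -/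
def AK : Γ.H →ₗ.[ℝ] Γ.H :=
  Γ.AKmax.domRestrict ((LinearMap.ker Γ.BK).map Γ.AKmax.domain.subtype)

end QuantumGraph

section Operators

variable {X : Type*} [NormedAddCommGroup X] [NormedSpace ℝ X]

/-- A `C₀`-semigroup (strongly continuous semigroup) of bounded operators on `X`. -/
structure C0Semigroup (X : Type*) [NormedAddCommGroup X] [NormedSpace ℝ X] where
  S : ℝ≥0 → X →L[ℝ] X
  map_zero : S 0 = ContinuousLinearMap.id ℝ X
  map_add : ∀ s t, S (s + t) = (S s).comp (S t)
  continuous_orbit : ∀ x, Continuous fun t => S t x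

/-- `A` is the generator of the semigroup `T`: `x ∈ D(A)` and `A x = y` if and only if
`(S(t) x - x) / t → y` as `t → 0+`. -/
def C0Semigroup.IsGenerator (T : C0Semigroup X) (A : X →ₗ.[ℝ] X) : Prop :=
  ∀ x y : X, (x, y) ∈ A.graph ↔
    Tendsto (fun t : ℝ≥0 => (t : ℝ)⁻¹ • (T.S t x - x)) (𝓝[>] 0) (𝓝 y)

/-- `A` generates a `C₀`-semigroup. -/
def GeneratesC0Semigroup (A : X →ₗ.[ℝ] X) : Prop := ∃ T : C0Semigroup X, T.IsGenerator A

/-- The map `μ - A : D(A) → X`. -/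
def subOp (A : X →ₗ.[ℝ] X) (μ : ℝ) : A.domain →ₗ[ℝ] X := μ • A.domain.subtype - A.toFun

/-- The resolvent set: all `μ` such that `μ - A : D(A) → X` is bijective with bounded inverse. -/
def resolventSet (A : X →ₗ.[ℝ] X) : Set ℝ :=
  {μ | Function.Bijective (subOp A μ) ∧ ∃ R : X →L[ℝ] X, ∀ x, R (subOp A μ x) = x}

/-- `D` is a bounded two-sided inverse of the restriction of `B : D(M) → Y` to `Ker(μ - M)`. -/
def IsDirichletOperator {Y : Type*} [NormedAddCommGroup Y] [NormedSpace ℝ Y] (M : X →ₗ.[ℝ] X)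
    (B : M.domain →ₗ[ℝ] Y) (μ : ℝ) (D : Y →L[ℝ] X) : Prop :=
  Function.Bijective (B.domRestrict (LinearMap.ker (subOp M μ))) ∧
    ∀ u : LinearMap.ker (subOp M μ), D (B u) = ((u : M.domain) : X)

end Operators

end QG

end

/-!
On every edge the initial value problem for `μ u - ((c u')' - p u) = h` is solvable for arbitrary
`h`, `u(0)` and `(c u')(0)`: its Picard iteration is of Volterra type. Hence `μ - A_max` is
surjective and `Ker (μ - A_max)` has dimension at least `2m`, the dimension of the boundary space.

Integration by parts on the edges leaves boundary terms which, collected at the vertices, cancel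
for functions in `Ker B`. So `A` is dissipative, and for `μ > 0` the operator `B` is injective on
`Ker (μ - A_max)`; by the dimension count it is bijective there. A preimage under `μ - A_max` can
therefore be corrected to lie in `D(A) = Ker B`, so `μ - A` is surjective for `μ > 0` and `A`
generates a contraction semigroup by the Lumer-Phillips theorem. The bijectivity at `μ = 1` shows
in particular that `B` and `B_K` are surjective, and for arbitrary `μ ∈ ρ(A)` a preimage under `B`
is corrected by an element of `D(A)` to lie in `Ker (μ - A_max)`.
-/

noncomputable section

namespace QG

theorem subOp_apply {X : Type*} [NormedAddCommGroup X] [NormedSpace ℝ X]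
    (A : X →ₗ.[ℝ] X) (μ : ℝ) (x : A.domain) :
    subOp A μ x = μ • (x : X) - A x := rfl

section DenseConvergence

variable {X Y ι : Type*} [NormedAddCommGroup X] [NormedSpace ℝ X] [NormedAddCommGroup Y]
  [NormedSpace ℝ Y] {F : ι → X →L[ℝ] Y} {C : ℝ} {l : Filter ι} {s : Set X}

theorem cauchy_map_of_equicontinuousAt {X Y ι : Type*} [TopologicalSpace X] [UniformSpace Y]
    {F : ι → X → Y} {l : Filter ι} {s : Set X} {x : X} (hF : EquicontinuousAt F x)
    (hs : ∀ y ∈ s, Cauchy (map (F · y) l)) (hx : x ∈ closure s) : Cauchy (map (F · x) l) := by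
  obtain ⟨y₀, hy₀⟩ := closure_nonempty_iff.1 ⟨x, hx⟩
  refine ⟨(map_neBot_iff _).2 ((map_neBot_iff _).1 (hs y₀ hy₀).1), fun U hU => ?_⟩
  obtain ⟨W, hW, hWsymm, hWU⟩ := comp_comp_symm_mem_uniformity_sets hU
  obtain ⟨y, hxy, hy⟩ := mem_closure_iff_nhds.1 hx _ (hF W hW)
  have hWy := (hs y hy).2 hW
  rw [prod_map_map_eq] at hWy ⊢
  refine mem_map.2 (mem_of_superset (mem_map.1 hWy) fun p hp => ?_)
  exact hWU ⟨_, ⟨_, hxy p.1, hp⟩, hWsymm.symm _ _ (hxy p.2)⟩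

theorem equicontinuous_of_norm_le (hF : ∀ i, ‖F i‖ ≤ C) : Equicontinuous fun i => ⇑(F i) :=
  ((NormedSpace.equicontinuous_TFAE F).out 5 1 :
    (∃ C, ∀ i, ‖F i‖ ≤ C) ↔ Equicontinuous fun i => ⇑(F i)).1 ⟨C, hF⟩

theorem tendsto_apply_of_dense (hF : ∀ i, ‖F i‖ ≤ C) (hs : Dense s) (G : X →L[ℝ] Y)
    (h : ∀ z ∈ s, Tendsto (F · z) l (𝓝 (G z))) (x : X) : Tendsto (F · x) l (𝓝 (G x)) :=
  (equicontinuous_of_norm_le hF x).tendsto_of_mem_closure G.continuous.continuousWithinAt h (hs x)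

theorem tendsto_apply_of_tendsto (hF : ∀ i, ‖F i‖ ≤ C) {x : X} {y : Y} {u : ι → X}
    (hu : Tendsto u l (𝓝 x)) (hx : Tendsto (F · x) l (𝓝 y)) :
    Tendsto (fun i => F i (u i)) l (𝓝 y) := by
  have hdiff : Tendsto (fun i => F i (u i - x)) l (𝓝 0) := by
    refine squeeze_zero_norm (fun i => (F i).le_of_opNorm_le (hF i) _) ?_
    simpa using ((hu.sub_const x).norm.const_mul C)
  simpa using hdiff.add hx

end DenseConvergence

section Exponential

variable {X : Type*} [NormedAddCommGroup X] [NormedSpace ℝ X]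

/-- The bounded operator `B` generates a semigroup of contractions. -/
def GeneratesContractions (B : X →L[ℝ] X) : Prop :=
  ∀ t : ℝ, 0 ≤ t → ‖NormedSpace.exp (t • B)‖ ≤ 1

theorem norm_exp_le (B : X →L[ℝ] X) : ‖NormedSpace.exp B‖ ≤ Real.exp ‖B‖ := by
  rw [NormedSpace.exp_eq_tsum ℝ, Real.exp_eq_exp_ℝ, NormedSpace.exp_eq_tsum ℝ]
  refine tsum_of_norm_bounded (NormedSpace.expSeries_summable' ‖B‖).hasSum fun n => ?_
  rw [norm_smul, Real.norm_of_nonneg (by positivity), smul_eq_mul]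
  gcongr
  rcases n.eq_zero_or_pos with rfl | hn
  · rw [pow_zero, pow_zero]
    exact ContinuousLinearMap.norm_id_le
  · exact norm_pow_le' B hn

variable [CompleteSpace X]

theorem exp_add_of_commute {B C : X →L[ℝ] X} (h : Commute B C) :
    NormedSpace.exp (B + C) = NormedSpace.exp B * NormedSpace.exp C := by
  let _ : NormedAlgebra ℚ (X →L[ℝ] X) := NormedAlgebra.restrictScalars ℚ ℝ _
  exact NormedSpace.exp_add_of_commute h

theorem hasDerivAt_exp_smul_apply (B : X →L[ℝ] X) (x : X) (s : ℝ) :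
    HasDerivAt (fun s : ℝ => NormedSpace.exp (s • B) x) (NormedSpace.exp (s • B) (B x)) s := by
  simpa using (hasDerivAt_exp_smul_const (𝕂 := ℝ) B s).clm_apply (hasDerivAt_const s x)

/- `s ↦ exp (s B) exp ((t - s) C) x` interpolates between the two orbits at time `t`; its
derivative is `exp (s B) exp ((t - s) C) (B x - C x)`. -/
theorem norm_exp_smul_sub_exp_smul_le {B C : X →L[ℝ] X} (hB : GeneratesContractions B)
    (hC : GeneratesContractions C) (hBC : Commute B C) {t : ℝ} (ht : 0 ≤ t) (x : X) :
    ‖NormedSpace.exp (t • B) x - NormedSpace.exp (t • C) x‖ ≤ t * ‖B x - C x‖ := by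
  have hinterp (s : ℝ) (y : X) : NormedSpace.exp (t • C) (NormedSpace.exp (s • (B - C)) y)
      = NormedSpace.exp (s • B) (NormedSpace.exp ((t - s) • C) y) := by
    rw [← mul_apply_eq_comp, ← mul_apply_eq_comp, ← exp_add_of_commute, ← exp_add_of_commute]
    · congr 2
      rw [smul_sub, sub_smul]
      abel
    · exact (hBC.smul_left s).smul_right (t - s)
    · exact ((hBC.symm.sub_right (Commute.refl C)).smul_right s).smul_left t
  have hderiv (s : ℝ) := (NormedSpace.exp (t • C)).hasFDerivAt.comp_hasDerivAt s
    (hasDerivAt_exp_smul_apply (B - C) x s)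
  have hbound (s : ℝ) (hs : s ∈ Ico 0 t) :
      ‖NormedSpace.exp (t • C) (NormedSpace.exp (s • (B - C)) ((B - C) x))‖ ≤ ‖B x - C x‖ := by
    rw [hinterp]
    refine (ContinuousLinearMap.le_of_opNorm_le _ (hB s hs.1) _).trans ?_
    rw [one_mul]
    exact (ContinuousLinearMap.le_of_opNorm_le _ (hC (t - s) (sub_nonneg.2 hs.2.le)) _).trans_eq
      (one_mul _)
  have hsegment := norm_image_sub_le_of_norm_deriv_le_segment'
    (fun s _ => (hderiv s).hasDerivWithinAt) hbound t ⟨ht, le_rfl⟩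
  simpa only [Function.comp_apply, hinterp, sub_self, zero_smul, NormedSpace.exp_zero,
    one_apply_eq_self, sub_zero, mul_comm] using hsegment

end Exponential

/-- The bounded operators `B n` commute, generate contractions, and converge pointwise to the
densely defined operator `A` on its domain. This is what the Yosida approximations of `A`
satisfy, and all that is needed to construct the semigroup of `A`. -/
structure IsContractiveApproximation {X : Type*} [NormedAddCommGroup X] [NormedSpace ℝ X]
    (A : X →ₗ.[ℝ] X) (B : ℕ → X →L[ℝ] X) : Prop where
  dense_domain : Dense (A.domain : Set X)
  generatesContractions : ∀ n, GeneratesContractions (B n)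
  commute : ∀ n m, Commute (B n) (B m)
  tendsto : ∀ x : A.domain, Tendsto (fun n => B n x) atTop (𝓝 (A x))

namespace IsContractiveApproximation

variable {X : Type*} [NormedAddCommGroup X] [NormedSpace ℝ X] [CompleteSpace X]
  {A : X →ₗ.[ℝ] X} {B : ℕ → X →L[ℝ] X}

theorem cauchySeq_exp (h : IsContractiveApproximation A B) (t : ℝ≥0) (x : X) :
    CauchySeq fun n => NormedSpace.exp ((t : ℝ) • B n) x := by
  refine cauchy_map_of_equicontinuousAt
    (equicontinuous_of_norm_le (fun n => h.generatesContractions n t t.2) x) (fun z hz => ?_)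
    (h.dense_domain x)
  refine cauchySeq_iff_tendsto_dist_atTop_0.2 ?_
  have hB := (cauchySeq_iff_tendsto_dist_atTop_0.1 (h.tendsto ⟨z, hz⟩).cauchySeq).const_mul (t : ℝ)
  rw [mul_zero] at hB
  refine squeeze_zero (fun _ => dist_nonneg) (fun n => ?_) hB
  rw [dist_eq_norm, dist_eq_norm]
  exact norm_exp_smul_sub_exp_smul_le (h.generatesContractions _) (h.generatesContractions _)
    (h.commute _ _) t.2 z

theorem exists_tendsto_exp (h : IsContractiveApproximation A B) (t : ℝ≥0) :
    ∃ S : X →L[ℝ] X, ∀ x, Tendsto (fun n => NormedSpace.exp ((t : ℝ) • B n) x) atTop (𝓝 (S x)) := by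
  choose S hS using fun x => cauchySeq_tendsto_of_complete (h.cauchySeq_exp t x)
  exact ⟨continuousLinearMapOfTendsto _ (tendsto_pi_nhds.2 hS), hS⟩

/-- The pointwise limit of the operators `exp (t • B n)`. -/
def limit (h : IsContractiveApproximation A B) (t : ℝ≥0) : X →L[ℝ] X :=
  (h.exists_tendsto_exp t).choose

theorem tendsto_exp (h : IsContractiveApproximation A B) (t : ℝ≥0) (x : X) :
    Tendsto (fun n => NormedSpace.exp ((t : ℝ) • B n) x) atTop (𝓝 (h.limit t x)) :=
  (h.exists_tendsto_exp t).choose_spec x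

theorem norm_limit_le (h : IsContractiveApproximation A B) (t : ℝ≥0) : ‖h.limit t‖ ≤ 1 :=
  ContinuousLinearMap.opNorm_le_bound _ zero_le_one fun x =>
    le_of_tendsto (h.tendsto_exp t x).norm <| Eventually.of_forall fun n =>
      ContinuousLinearMap.le_of_opNorm_le _ (h.generatesContractions n t t.2) x

theorem norm_exp_sub_limit_le (h : IsContractiveApproximation A B) (n : ℕ) (t : ℝ≥0)
    (x : A.domain) :
    ‖NormedSpace.exp ((t : ℝ) • B n) x - h.limit t x‖ ≤ t * ‖B n x - A x‖ :=
  le_of_tendsto_of_tendsto ((h.tendsto_exp t x).const_sub _).norm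
    (((h.tendsto x).const_sub _).norm.const_mul _) <| Eventually.of_forall fun m =>
      norm_exp_smul_sub_exp_smul_le (h.generatesContractions n) (h.generatesContractions m)
        (h.commute n m) t.2 (x : X)

theorem limit_zero (h : IsContractiveApproximation A B) :
    h.limit 0 = ContinuousLinearMap.id ℝ X := by
  ext x
  refine tendsto_nhds_unique (h.tendsto_exp 0 x) ?_
  simp

theorem limit_add (h : IsContractiveApproximation A B) (s t : ℝ≥0) :
    h.limit (s + t) = (h.limit s).comp (h.limit t) := by
  ext x
  refine tendsto_nhds_unique (h.tendsto_exp (s + t) x) ?_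
  have hcomp := tendsto_apply_of_tendsto (fun n => h.generatesContractions n s s.2)
    (h.tendsto_exp t x) (h.tendsto_exp s (h.limit t x))
  refine hcomp.congr fun n => ?_
  rw [← mul_apply_eq_comp, ← exp_add_of_commute, ← add_smul, NNReal.coe_add]
  exact ((Commute.refl (B n)).smul_left _).smul_right _

theorem continuous_limit_apply (h : IsContractiveApproximation A B) (x : X) :
    Continuous fun t => h.limit t x := by
  refine continuous_iff_continuousAt.2 fun t₀ =>
    tendsto_apply_of_dense h.norm_limit_le h.dense_domain (h.limit t₀) (fun z hz => ?_) x
  suffices hunif : TendstoLocallyUniformly (fun n (t : ℝ≥0) => NormedSpace.exp ((t : ℝ) • B n) z)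
      (fun t => h.limit t z) atTop by
    refine (hunif.continuous (Frequently.of_forall fun n => ?_)).continuousAt
    exact (continuous_iff_continuousAt.2 fun s =>
      (hasDerivAt_exp_smul_apply (B n) z s).continuousAt).comp NNReal.continuous_coe
  refine Metric.tendstoLocallyUniformly_iff.2 fun ε hε t₁ => ⟨Iio (t₁ + 1), ?_, ?_⟩
  · exact Iio_mem_nhds (lt_add_one t₁)
  have hlim := ((h.tendsto ⟨z, hz⟩).sub_const (A ⟨z, hz⟩)).norm.const_mul ((t₁ : ℝ) + 1)
  rw [sub_self, norm_zero, mul_zero] at hlim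
  filter_upwards [hlim.eventually_lt_const hε] with n hn t ht
  rw [dist_comm, dist_eq_norm]
  refine (h.norm_exp_sub_limit_le n t ⟨z, hz⟩).trans_lt (lt_of_le_of_lt ?_ hn)
  gcongr
  exact_mod_cast (mem_Iio.1 ht).le

/-- The semigroup of the pointwise limits of `exp (t • B n)`. -/
def semigroup (h : IsContractiveApproximation A B) : C0Semigroup X where
  S := h.limit
  map_zero := h.limit_zero
  map_add := h.limit_add
  continuous_orbit := h.continuous_limit_apply

/- The comparison estimate replaces the difference quotient of the limit semigroup, uniformly in
`t`, by the one of `exp (t • B n)`, whose limit is `B n x`. -/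
theorem tendsto_differenceQuotient (h : IsContractiveApproximation A B) (x : A.domain) :
    Tendsto (fun t : ℝ≥0 => (t : ℝ)⁻¹ • (h.semigroup.S t x - x)) (𝓝[>] 0) (𝓝 (A x)) := by
  have hcoe : Tendsto ((↑) : ℝ≥0 → ℝ) (𝓝[>] 0) (𝓝[>] 0) :=
    tendsto_nhdsWithin_iff.2 ⟨(NNReal.continuous_coe.tendsto' 0 0 rfl).mono_left nhdsWithin_le_nhds,
      eventually_mem_nhdsWithin⟩
  have hexp (n : ℕ) : Tendsto (fun t : ℝ≥0 => (t : ℝ)⁻¹ • (NormedSpace.exp ((t : ℝ) • B n) x - x))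
      (𝓝[>] 0) (𝓝 (B n x)) := by
    have hslope := (hasDerivAt_exp_smul_apply (B n) (x : X) 0).tendsto_slope_zero_right
    simp only [zero_add, zero_smul, NormedSpace.exp_zero, one_apply_eq_self] at hslope
    exact hslope.comp hcoe
  refine TendstoUniformlyOnFilter.tendsto_of_eventually_tendsto (p := atTop) ?_
    (Eventually.of_forall hexp) (h.tendsto x)
  refine Metric.tendstoUniformlyOnFilter_iff.2 fun ε hε => ?_
  have hlim := ((h.tendsto x).sub_const (A x)).norm
  rw [sub_self, norm_zero] at hlim
  filter_upwards [(hlim.eventually_lt_const hε).prod_mk self_mem_nhdsWithin] with ⟨n, t⟩ ⟨hn, ht⟩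
  have ht0 : (0 : ℝ) < t := ht
  rw [dist_comm, dist_eq_norm, ← smul_sub, sub_sub_sub_cancel_right, norm_smul, norm_inv,
    Real.norm_of_nonneg ht0.le, inv_mul_lt_iff₀ ht0]
  exact (h.norm_exp_sub_limit_le n t x).trans_lt (mul_lt_mul_of_pos_left hn ht0)

end IsContractiveApproximation

section Resolvent

variable {X : Type*} [NormedAddCommGroup X] [NormedSpace ℝ X] {A : X →ₗ.[ℝ] X} {μ ν : ℝ}
  {R R' : X →L[ℝ] X}

/-- `R` is the resolvent `(μ - A)⁻¹`. -/
def IsResolvent (A : X →ₗ.[ℝ] X) (μ : ℝ) (R : X →L[ℝ] X) : Prop :=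
  Function.Surjective (subOp A μ) ∧ ∀ x, R (subOp A μ x) = x

/-- The Yosida approximation `μ A (μ - A)⁻¹ = μ (μ (μ - A)⁻¹ - 1)` of `A`, expressed through the
resolvent `R = (μ - A)⁻¹`. -/
def yosida (μ : ℝ) (R : X →L[ℝ] X) : X →L[ℝ] X := μ • (μ • R - 1)

theorem IsResolvent.mem_resolventSet (hR : IsResolvent A μ R) : μ ∈ resolventSet A :=
  ⟨⟨fun x y hxy => Subtype.ext (by rw [← hR.2 x, ← hR.2 y, hxy]), hR.1⟩, R, hR.2⟩

theorem IsResolvent.sub_apply_eq_smul (hR : IsResolvent A μ R) (hR' : IsResolvent A ν R') (y : X) :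
    R' y - R y = (μ - ν) • R (R' y) := by
  obtain ⟨x, rfl⟩ := hR'.1 y
  have hx : subOp A ν x = subOp A μ x - (μ - ν) • (x : X) := by
    rw [subOp_apply, subOp_apply, sub_smul]
    abel
  rw [hR'.2 x, hx, map_sub, hR.2 x, map_smul, sub_sub_cancel]

theorem IsResolvent.commute (hR : IsResolvent A μ R) (hR' : IsResolvent A ν R') :
    Commute R R' := by
  ext y
  rcases eq_or_ne μ ν with rfl | hne
  · have hRR' (y : X) : R' y = R y :=
      sub_eq_zero.1 ((hR.sub_apply_eq_smul hR' y).trans (by rw [sub_self, zero_smul]))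
    simp only [mul_apply_eq_comp, hRR']
  · refine smul_right_injective X (sub_ne_zero.2 hne) ?_
    calc (μ - ν) • R (R' y) = -(R y - R' y) := by
          rw [← hR.sub_apply_eq_smul hR' y, neg_sub]
      _ = (μ - ν) • R' (R y) := by
          rw [hR'.sub_apply_eq_smul hR y, ← neg_smul, neg_sub]

theorem IsResolvent.smul_apply_sub (hR : IsResolvent A μ R) (x : A.domain) :
    μ • R x - x = R (A x) := by
  have hx := hR.2 x
  rw [subOp_apply, map_sub, map_smul] at hx
  exact sub_eq_of_eq_add' (sub_eq_iff_eq_add.1 hx)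

theorem IsResolvent.yosida_apply (hR : IsResolvent A μ R) (x : A.domain) :
    yosida μ R x = μ • R (A x) := by
  rw [← hR.smul_apply_sub x]
  rfl

theorem commute_yosida (h : Commute R R') : Commute (yosida μ R) (yosida ν R') := by
  have hsub : Commute (μ • R - 1) (ν • R' - 1) :=
    (((h.smul_left μ).smul_right ν).sub_right (Commute.one_right _)).sub_left (Commute.one_left _)
  exact (hsub.smul_left μ).smul_right ν

theorem generatesContractions_yosida [CompleteSpace X] (hμ : 0 ≤ μ) (hR : ‖μ • R‖ ≤ 1) :
    GeneratesContractions (yosida μ R) := by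
  intro t ht
  have hsplit : t • yosida μ R = (t * μ) • (μ • R) + (-(t * μ)) • 1 := by
    rw [yosida, smul_smul, smul_sub, neg_smul, sub_eq_add_neg]
  have hscalar : NormedSpace.exp ((-(t * μ)) • (1 : X →L[ℝ] X)) = Real.exp (-(t * μ)) • 1 := by
    have h := NormedSpace.algebraMap_exp_comm (𝔸 := X →L[ℝ] X) (-(t * μ))
    rw [Algebra.algebraMap_eq_smul_one, Algebra.algebraMap_eq_smul_one] at h
    rw [← h, Real.exp_eq_exp_ℝ]
  rw [hsplit, exp_add_of_commute ((Commute.one_right _).smul_right _), hscalar, mul_smul_comm,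
    mul_one, norm_smul, Real.norm_of_nonneg (Real.exp_nonneg _)]
  calc Real.exp (-(t * μ)) * ‖NormedSpace.exp ((t * μ) • (μ • R))‖
      ≤ Real.exp (-(t * μ)) * Real.exp (t * μ) := by
        gcongr
        refine (norm_exp_le _).trans (Real.exp_le_exp.2 ?_)
        rw [norm_smul, Real.norm_of_nonneg (by positivity)]
        exact mul_le_of_le_one_right (by positivity) hR
    _ = 1 := by rw [← Real.exp_add, neg_add_cancel, Real.exp_zero]

end Resolvent

section Dissipative

variable {X : Type*} [NormedAddCommGroup X] [NormedSpace ℝ X] {A : X →ₗ.[ℝ] X} {μ : ℝ}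
  {R : X →L[ℝ] X}

/-- `A` is dissipative. In a Hilbert space this amounts to `⟪A x, x⟫ ≤ 0`. -/
def IsDissipative (A : X →ₗ.[ℝ] X) : Prop :=
  ∀ μ : ℝ, 0 < μ → ∀ x : A.domain, μ * ‖(x : X)‖ ≤ ‖subOp A μ x‖

namespace IsDissipative

theorem injective_subOp (hA : IsDissipative A) (hμ : 0 < μ) : Function.Injective (subOp A μ) := by
  refine (injective_iff_map_eq_zero _).2 fun x hx => Subtype.ext (norm_le_zero_iff.1 ?_)
  have hle := hA μ hμ x
  rw [hx, norm_zero] at hle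
  exact nonpos_of_mul_nonpos_right hle hμ

theorem exists_isResolvent (hA : IsDissipative A) (hμ : 0 < μ)
    (hs : Function.Surjective (subOp A μ)) : ∃ R, IsResolvent A μ R := by
  let e := LinearEquiv.ofBijective (subOp A μ) ⟨hA.injective_subOp hμ, hs⟩
  refine ⟨LinearMap.mkContinuous (A.domain.subtype ∘ₗ e.symm.toLinearMap) μ⁻¹ fun y => ?_, hs,
    fun x => congrArg Subtype.val (e.symm_apply_apply x)⟩
  obtain ⟨x, rfl⟩ := e.surjective y
  rw [LinearMap.comp_apply, LinearEquiv.coe_coe, e.symm_apply_apply, ← div_eq_inv_mul,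
    le_div_iff₀' hμ]
  exact hA μ hμ x

theorem norm_smul_resolvent_le (hA : IsDissipative A) (hμ : 0 < μ) (hR : IsResolvent A μ R) :
    ‖μ • R‖ ≤ 1 := by
  refine ContinuousLinearMap.opNorm_le_bound _ zero_le_one fun y => ?_
  obtain ⟨x, rfl⟩ := hR.1 y
  rw [smul_apply, hR.2, norm_smul, Real.norm_of_nonneg hμ.le, one_mul]
  exact hA μ hμ x

theorem tendsto_smul_resolvent (hA : IsDissipative A) (hdense : Dense (A.domain : Set X))
    {μ : ℕ → ℝ} {R : ℕ → X →L[ℝ] X} (hμ : ∀ n, 0 < μ n) (hμ_lim : Tendsto μ atTop atTop)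
    (hR : ∀ n, IsResolvent A (μ n) (R n)) (y : X) :
    Tendsto (fun n => (μ n • R n) y) atTop (𝓝 y) := by
  refine tendsto_apply_of_dense (fun n => hA.norm_smul_resolvent_le (hμ n) (hR n)) hdense
    (ContinuousLinearMap.id ℝ X) (fun z hz => ?_) y
  rw [tendsto_iff_norm_sub_tendsto_zero]
  have hinv := hμ_lim.inv_tendsto_atTop.mul_const ‖A ⟨z, hz⟩‖
  rw [zero_mul] at hinv
  refine squeeze_zero (fun _ => norm_nonneg _) (fun n => ?_) hinv
  have hz' : (μ n • R n) z - z = R n (A ⟨z, hz⟩) := (hR n).smul_apply_sub ⟨z, hz⟩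
  have hle := (μ n • R n).le_of_opNorm_le (hA.norm_smul_resolvent_le (hμ n) (hR n)) (A ⟨z, hz⟩)
  rw [smul_apply, norm_smul, Real.norm_of_nonneg (hμ n).le, one_mul] at hle
  rw [ContinuousLinearMap.id_apply, hz', Pi.inv_apply, ← div_eq_inv_mul, le_div_iff₀' (hμ n)]
  exact hle

theorem isContractiveApproximation_yosida [CompleteSpace X] (hA : IsDissipative A)
    (hdense : Dense (A.domain : Set X)) {μ : ℕ → ℝ} {R : ℕ → X →L[ℝ] X} (hμ : ∀ n, 0 < μ n)
    (hμ_lim : Tendsto μ atTop atTop) (hR : ∀ n, IsResolvent A (μ n) (R n)) :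
    IsContractiveApproximation A fun n => yosida (μ n) (R n) where
  dense_domain := hdense
  generatesContractions n :=
    generatesContractions_yosida (hμ n).le (hA.norm_smul_resolvent_le (hμ n) (hR n))
  commute n m := commute_yosida ((hR n).commute (hR m))
  tendsto x := (hA.tendsto_smul_resolvent hdense hμ hμ_lim hR (A x)).congr fun n =>
    ((hR n).yosida_apply x).symm

end IsDissipative

theorem C0Semigroup.mul_norm_le_of_tendsto {T : C0Semigroup X} (hT : ∀ t, ‖T.S t‖ ≤ 1) {x y : X}
    (hxy : Tendsto (fun t : ℝ≥0 => (t : ℝ)⁻¹ • (T.S t x - x)) (𝓝[>] 0) (𝓝 y)) (μ : ℝ) :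
    μ * ‖x‖ ≤ ‖μ • x - y‖ := by
  refine ge_of_tendsto (hxy.const_sub (μ • x)).norm ?_
  filter_upwards [self_mem_nhdsWithin] with t ht
  have ht0 : (0 : ℝ) < t := ht
  have hTx : ‖(t : ℝ)⁻¹ • T.S t x‖ ≤ (t : ℝ)⁻¹ * ‖x‖ := by
    rw [norm_smul, norm_inv, Real.norm_of_nonneg ht0.le]
    gcongr
    exact ((T.S t).le_of_opNorm_le (hT t) x).trans_eq (one_mul _)
  calc μ * ‖x‖ = (μ + (t : ℝ)⁻¹) * ‖x‖ - (t : ℝ)⁻¹ * ‖x‖ := by ring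
    _ ≤ ‖(μ + (t : ℝ)⁻¹) • x‖ - ‖(t : ℝ)⁻¹ • T.S t x‖ := by
        rw [norm_smul]
        gcongr
        exact le_abs_self _
    _ ≤ ‖(μ + (t : ℝ)⁻¹) • x - (t : ℝ)⁻¹ • T.S t x‖ := norm_sub_norm_le _ _
    _ = ‖μ • x - (t : ℝ)⁻¹ • (T.S t x - x)‖ := by
        congr 1
        rw [add_smul, smul_sub]
        abel

/- The generator of `T` extends `A`, and it is dissipative; since `1 - A` is already surjective,
the extension is not proper. -/
theorem C0Semigroup.isGenerator_of_tendsto {T : C0Semigroup X} (hT : ∀ t, ‖T.S t‖ ≤ 1)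
    (hlim : ∀ x : A.domain,
      Tendsto (fun t : ℝ≥0 => (t : ℝ)⁻¹ • (T.S t x - x)) (𝓝[>] 0) (𝓝 (A x)))
    (hs : Function.Surjective (subOp A 1)) : T.IsGenerator A := by
  refine fun x y => ⟨fun hxy => ?_, fun hxy => ?_⟩
  · obtain ⟨z, rfl, rfl⟩ := (LinearPMap.mem_graph_iff A).1 hxy
    exact hlim z
  · obtain ⟨z, hz⟩ := hs (x - y)
    rw [subOp_apply, one_smul] at hz
    have hdiff : Tendsto (fun t : ℝ≥0 => (t : ℝ)⁻¹ • (T.S t (x - z) - (x - z))) (𝓝[>] 0)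
        (𝓝 (y - A z)) := by
      refine (hxy.sub (hlim z)).congr fun t => ?_
      rw [← smul_sub, map_sub, sub_sub_sub_comm]
    have hle := mul_norm_le_of_tendsto hT hdiff 1
    rw [one_smul, sub_sub_sub_comm, hz, sub_self, norm_zero, one_mul] at hle
    have hxz : x = z := sub_eq_zero.1 (norm_le_zero_iff.1 hle)
    refine (LinearPMap.mem_graph_iff A).2 ⟨z, hxz.symm, ?_⟩
    rw [hxz] at hz
    exact sub_right_injective hz

theorem IsDissipative.generatesC0Semigroup [CompleteSpace X] (hA : IsDissipative A)
    (hdense : Dense (A.domain : Set X))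
    (hs : ∀ μ : ℝ, 0 < μ → Function.Surjective (subOp A μ)) : GeneratesC0Semigroup A := by
  have hpos (n : ℕ) : (0 : ℝ) < n + 1 := by positivity
  choose R hR using fun n : ℕ => hA.exists_isResolvent (hpos n) (hs _ (hpos n))
  have happrox := hA.isContractiveApproximation_yosida hdense hpos
    (tendsto_atTop_add_const_right _ _ tendsto_natCast_atTop_atTop) hR
  exact ⟨happrox.semigroup, C0Semigroup.isGenerator_of_tendsto happrox.norm_limit_le
    happrox.tendsto_differenceQuotient (hs 1 one_pos)⟩

end Dissipative

section LumerPhillips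

variable {X : Type*} [NormedAddCommGroup X] [InnerProductSpace ℝ X] {A : X →ₗ.[ℝ] X}

theorem isDissipative_of_inner_nonpos (hA : ∀ x : A.domain, inner ℝ (A x) (x : X) ≤ 0) :
    IsDissipative A := by
  intro μ _ x
  rcases (norm_nonneg (x : X)).eq_or_lt with h0 | hpos
  · rw [← h0, mul_zero]
    exact norm_nonneg _
  · refine le_of_mul_le_mul_right ?_ hpos
    calc μ * ‖(x : X)‖ * ‖(x : X)‖
        ≤ μ * (‖(x : X)‖ * ‖(x : X)‖) - inner ℝ (A x) (x : X) := by linarith [hA x]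
      _ = inner ℝ (subOp A μ x) (x : X) := by
          rw [subOp_apply, inner_sub_left, real_inner_smul_left, real_inner_self_eq_norm_mul_norm]
      _ ≤ ‖subOp A μ x‖ * ‖(x : X)‖ := real_inner_le_norm _ _

theorem dense_domain_of_inner_nonpos [CompleteSpace X]
    (hA : ∀ x : A.domain, inner ℝ (A x) (x : X) ≤ 0)
    (hs : Function.Surjective (subOp A 1)) : Dense (A.domain : Set X) := by
  rw [Submodule.dense_iff_topologicalClosure_eq_top,
    Submodule.topologicalClosure_eq_top_iff, Submodule.eq_bot_iff]
  intro v hv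
  obtain ⟨w, rfl⟩ := hs v
  have horth := (Submodule.mem_orthogonal' _ _).1 hv w w.2
  rw [subOp_apply, inner_sub_left, one_smul, sub_eq_zero] at horth
  have hw : w = 0 := Subtype.ext (real_inner_self_nonpos.1 (horth.trans_le (hA w)))
  rw [hw, map_zero]

theorem generatesC0Semigroup_of_inner_nonpos [CompleteSpace X]
    (hA : ∀ x : A.domain, inner ℝ (A x) (x : X) ≤ 0)
    (hs : ∀ μ : ℝ, 0 < μ → Function.Surjective (subOp A μ)) : GeneratesC0Semigroup A :=
  (isDissipative_of_inner_nonpos hA).generatesC0Semigroup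
    (dense_domain_of_inner_nonpos hA (hs 1 one_pos)) hs

end LumerPhillips

section BoundaryOperator

variable {X Y : Type*} [NormedAddCommGroup X] [NormedSpace ℝ X] [AddCommGroup Y] [Module ℝ Y]
  {M : X →ₗ.[ℝ] X} {B : M.domain →ₗ[ℝ] Y} {μ : ℝ}

/-- The restriction of `M` to the kernel of the boundary operator `B : D(M) → Y`. The operators
`A`, `AKmax` and `AK` of a quantum graph are of this form by definition. -/
def kerRestrict (M : X →ₗ.[ℝ] X) (B : M.domain →ₗ[ℝ] Y) : X →ₗ.[ℝ] X :=
  M.domRestrict ((LinearMap.ker B).map M.domain.subtype)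

theorem kerRestrict_le : kerRestrict M B ≤ M := LinearPMap.domRestrict_le

theorem mem_domain_kerRestrict {x : X} :
    x ∈ (kerRestrict M B).domain ↔ ∃ hx : x ∈ M.domain, B ⟨x, hx⟩ = 0 := by
  constructor
  · rintro ⟨⟨w, hw, rfl⟩, -⟩
    exact ⟨w.2, hw⟩
  · rintro ⟨hx, hBx⟩
    exact ⟨⟨⟨x, hx⟩, hBx, rfl⟩, hx⟩

theorem kerRestrict_eq_kerRestrict_of_le {Z : Type*} [AddCommGroup Z] [Module ℝ Z]
    {N : X →ₗ.[ℝ] X} {C : N.domain →ₗ[ℝ] Z} (hN : N ≤ M)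
    (h : ∀ x : M.domain, (∃ hx : (x : X) ∈ N.domain, C ⟨x, hx⟩ = 0) ↔ B x = 0) :
    kerRestrict N C = kerRestrict M B := by
  have hdom : (kerRestrict N C).domain = (kerRestrict M B).domain := by
    ext x
    rw [mem_domain_kerRestrict, mem_domain_kerRestrict]
    exact ⟨fun ⟨hx, hCx⟩ => ⟨hN.1 hx, (h ⟨x, hN.1 hx⟩).1 ⟨hx, hCx⟩⟩,
      fun ⟨hx, hBx⟩ => (h ⟨x, hx⟩).2 hBx⟩
  have hle : kerRestrict N C ≤ M := kerRestrict_le.trans hN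
  refine LinearPMap.ext hdom fun x hx hx' => ?_
  rw [hle.2 (x := ⟨x, hx⟩) (y := ⟨x, hle.1 hx⟩) rfl,
    kerRestrict_le.2 (x := ⟨x, hx'⟩) (y := ⟨x, hle.1 hx⟩) rfl]

theorem subOp_eq_of_le {T : X →ₗ.[ℝ] X} (hT : T ≤ M) (μ : ℝ) (x : M.domain)
    (hx : (x : X) ∈ T.domain) : subOp T μ ⟨x, hx⟩ = subOp M μ x := by
  rw [subOp_apply, subOp_apply, hT.2 (x := ⟨x, hx⟩) (y := x) rfl]

theorem injective_domRestrict_ker (hinj : Function.Injective (subOp (kerRestrict M B) μ)) :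
    Function.Injective (B.domRestrict (LinearMap.ker (subOp M μ))) := by
  refine (injective_iff_map_eq_zero _).2 ?_
  rintro ⟨x, hx⟩ hBx
  have hmem : (x : X) ∈ (kerRestrict M B).domain := mem_domain_kerRestrict.2 ⟨x.2, hBx⟩
  have hzero : (⟨x, hmem⟩ : (kerRestrict M B).domain) = 0 :=
    hinj ((subOp_eq_of_le kerRestrict_le μ x hmem).trans (hx.trans (map_zero _).symm))
  have hx_zero : (x : X) = 0 := congrArg Subtype.val hzero
  exact Subtype.ext (Subtype.ext hx_zero)

theorem surjective_domRestrict_ker (hB : Function.Surjective B)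
    (hs : Function.Surjective (subOp (kerRestrict M B) μ)) :
    Function.Surjective (B.domRestrict (LinearMap.ker (subOp M μ))) := by
  intro y
  obtain ⟨x, rfl⟩ := hB y
  obtain ⟨⟨z, hz⟩, hzx⟩ := hs (subOp M μ x)
  obtain ⟨hzM, hBz⟩ := mem_domain_kerRestrict.1 hz
  rw [subOp_eq_of_le kerRestrict_le μ ⟨z, hzM⟩ hz] at hzx
  refine ⟨⟨x - ⟨z, hzM⟩, by rw [LinearMap.mem_ker, map_sub, hzx, sub_self]⟩, ?_⟩
  rw [LinearMap.domRestrict_apply, map_sub, hBz, sub_zero]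

theorem surjective_subOp_kerRestrict (hM : Function.Surjective (subOp M μ))
    (hB : Function.Surjective (B.domRestrict (LinearMap.ker (subOp M μ)))) :
    Function.Surjective (subOp (kerRestrict M B) μ) := by
  intro y
  obtain ⟨x, rfl⟩ := hM y
  obtain ⟨⟨z, hz⟩, hBz⟩ := hB (B x)
  have hmem : ((x - z : M.domain) : X) ∈ (kerRestrict M B).domain :=
    mem_domain_kerRestrict.2 ⟨(x - z).2, by
      rw [Subtype.coe_eta, map_sub, ← hBz, LinearMap.domRestrict_apply, sub_self]⟩
  refine ⟨⟨_, hmem⟩, ?_⟩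
  rw [subOp_eq_of_le kerRestrict_le, map_sub, LinearMap.mem_ker.1 hz, sub_zero]

end BoundaryOperator

theorem exists_isDirichletOperator {X Y : Type*} [NormedAddCommGroup X] [NormedSpace ℝ X]
    [NormedAddCommGroup Y] [NormedSpace ℝ Y] [FiniteDimensional ℝ Y] {M : X →ₗ.[ℝ] X}
    {B : M.domain →ₗ[ℝ] Y} {μ : ℝ} (hB : Function.Surjective B)
    (hμ : μ ∈ resolventSet (kerRestrict M B)) :
    ∃ D : Y →L[ℝ] X, IsDirichletOperator M B μ D := by
  have hbij : Function.Bijective (B.domRestrict (LinearMap.ker (subOp M μ))) :=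
    ⟨injective_domRestrict_ker hμ.1.1, surjective_domRestrict_ker hB hμ.1.2⟩
  let e := LinearEquiv.ofBijective _ hbij
  refine ⟨LinearMap.toContinuousLinearMap
    (M.domain.subtype ∘ₗ Submodule.subtype _ ∘ₗ e.symm.toLinearMap), hbij, fun u => ?_⟩
  exact congrArg (fun w : LinearMap.ker (subOp M μ) => ((w : M.domain) : X)) (e.symm_apply_apply u)

theorem bijective_of_injective_of_surjective_of_finrank_le {K E Y Z : Type*} [DivisionRing K]
    [AddCommGroup E] [Module K E] [AddCommGroup Y] [Module K Y] [FiniteDimensional K Y]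
    [AddCommGroup Z] [Module K Z] {f : E →ₗ[K] Y} {g : E →ₗ[K] Z} (hf : Function.Injective f)
    (hg : Function.Surjective g) (hYZ : Module.finrank K Y ≤ Module.finrank K Z) :
    Function.Bijective f := by
  have : FiniteDimensional K E := Module.Finite.of_injective f hf
  have hle := LinearMap.finrank_le_finrank_of_injective hf
  have hge := LinearMap.finrank_le_finrank_of_surjective hg
  exact ⟨hf, (LinearMap.injective_iff_surjective_of_finrank_eq_finrank (by omega)).1 hf⟩

section Primitive

variable {ℓ : ℝ}

theorem HasWeakDeriv.weakDeriv_eq {f : H1 ℓ} {g : L2 ℓ} (h : HasWeakDeriv (f : L2 ℓ) g) :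
    weakDeriv ℓ f = g :=
  (hasWeakDeriv_weakDeriv f).unique h

/-- A continuous function on `[0, ℓ]` as an element of `L²(0, ℓ)`. -/
def contToL2 (hℓ : 0 < ℓ) (F : C(Icc (0 : ℝ) ℓ, ℝ)) : L2 ℓ :=
  ((memLp_IccExtend hℓ F).mono_exponent le_top : MemLp _ 2 _).toLp

theorem contToL2_ae_eq (hℓ : 0 < ℓ) (F : C(Icc (0 : ℝ) ℓ, ℝ)) :
    (contToL2 hℓ F : ℝ → ℝ) =ᵐ[volume.restrict (Ioo 0 ℓ)] IccExtend hℓ.le F :=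
  MemLp.coeFn_toLp _

theorem mulBdd_contToLinf_contToL2 (hℓ : 0 < ℓ) (c F : C(Icc (0 : ℝ) ℓ, ℝ)) :
    mulBdd (contToLinf hℓ c) (contToL2 hℓ F) = contToL2 hℓ (c * F) := by
  apply Lp.ext
  filter_upwards [mulBdd_ae_eq (contToLinf hℓ c) (contToL2 hℓ F), contToLinf_ae_eq hℓ c,
    contToL2_ae_eq hℓ F, contToL2_ae_eq hℓ (c * F)] with t hmul hc hF hcF
  rw [hmul, hc, hF, hcF]
  rfl

theorem contRep_eq_of_eq_contToL2 (hℓ : 0 < ℓ) {F : C(Icc (0 : ℝ) ℓ, ℝ)} {f : H1 ℓ}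
    (h : (f : L2 ℓ) = contToL2 hℓ F) : contRep hℓ f = F := by
  apply contRep_unique hℓ
  have hF := contToL2_ae_eq hℓ F
  rw [← h] at hF
  exact (contRep_ae_eq hℓ f).symm.trans hF

/-- The primitive on `[0, ℓ]` with initial value `a` of a function in `L²(0, ℓ)`. -/
def primitive (hℓ : 0 < ℓ) (a : ℝ) (g : L2 ℓ) : C(Icc (0 : ℝ) ℓ, ℝ) where
  toFun x := a + ∫ t in (0 : ℝ)..x, g t
  continuous_toFun := continuousOn_iff_continuous_domRestrict.1
    (continuousOn_const.add (continuousOn_primitive hℓ g))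

theorem primitive_apply (hℓ : 0 < ℓ) (a : ℝ) (g : L2 ℓ) (x : Icc (0 : ℝ) ℓ) :
    primitive hℓ a g x = a + ∫ t in (0 : ℝ)..x, g t := rfl

theorem primitive_zero (hℓ : 0 < ℓ) (a : ℝ) (g : L2 ℓ) :
    primitive hℓ a g ⟨0, le_rfl, hℓ.le⟩ = a := by
  rw [primitive_apply, intervalIntegral.integral_same, add_zero]

theorem hasWeakDeriv_contToL2_primitive (hℓ : 0 < ℓ) (a : ℝ) (g : L2 ℓ) :
    HasWeakDeriv (contToL2 hℓ (primitive hℓ a g)) g := by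
  refine (hasWeakDeriv_iff hℓ).2 ⟨a, ?_⟩
  filter_upwards [contToL2_ae_eq hℓ (primitive hℓ a g), ae_restrict_mem measurableSet_Ioo]
    with x hx hx'
  rw [hx, IccExtend_eqOn hℓ _ (Ioo_subset_Icc_self hx'), primitive_apply]

theorem abs_primitive_sub_le (hℓ : 0 < ℓ) (a : ℝ) {g g' : L2 ℓ} {x : Icc (0 : ℝ) ℓ} {b : ℝ → ℝ}
    (hb : Continuous b)
    (h : ∀ᵐ t : ℝ ∂(volume.restrict (Ioo 0 ℓ)), t ≤ (x : ℝ) → |g t - g' t| ≤ b t) :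
    |primitive hℓ a g x - primitive hℓ a g' x| ≤ ∫ t in (0 : ℝ)..x, b t := by
  have hint (f : L2 ℓ) : IntervalIntegrable f volume 0 x :=
    (L2.intervalIntegrable hℓ.le f).mono_set (by
      rw [uIcc_of_le hℓ.le, uIcc_of_le x.2.1]
      exact Icc_subset_Icc_right x.2.2)
  rw [primitive_apply, primitive_apply, add_sub_add_left_eq_sub,
    ← intervalIntegral.integral_sub (hint g) (hint g')]
  refine intervalIntegral.norm_integral_le_of_norm_le (f := fun t => g t - g' t) x.2.1 ?_
    (hb.intervalIntegrable _ _)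
  filter_upwards [ae_Ioc_of_ae_Ioo h] with t ht htx
  exact ht ⟨htx.1, htx.2.trans x.2.2⟩ htx.2

end Primitive

section Volterra

variable {ℓ K : ℝ} {hℓ : 0 < ℓ} {T : C(Icc (0 : ℝ) ℓ, ℝ) → C(Icc (0 : ℝ) ℓ, ℝ)}

/-- `T` satisfies a Lipschitz estimate of Volterra type: the difference of two images at `x` is
controlled by the `L¹(0, x)` distance of the arguments. -/
def IsVolterra (hℓ : 0 < ℓ) (K : ℝ) (T : C(Icc (0 : ℝ) ℓ, ℝ) → C(Icc (0 : ℝ) ℓ, ℝ)) : Prop :=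
  ∀ u v x, |T u x - T v x| ≤ K * ∫ t in (0 : ℝ)..x, |IccExtend hℓ.le u t - IccExtend hℓ.le v t|

theorem IsVolterra.abs_iterate_sub_le (hT : IsVolterra hℓ K T) (hK : 0 ≤ K) (n : ℕ)
    (u v : C(Icc (0 : ℝ) ℓ, ℝ)) (x : Icc (0 : ℝ) ℓ) :
    |T^[n] u x - T^[n] v x| ≤ (K * x) ^ n / n.factorial * dist u v := by
  induction n generalizing x with
  | zero => simpa [Real.dist_eq] using ContinuousMap.dist_apply_le_dist (f := u) (g := v) x
  | succ n ih =>
    rw [Function.iterate_succ_apply', Function.iterate_succ_apply']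
    have hint : ∫ t in (0 : ℝ)..x, |IccExtend hℓ.le (T^[n] u) t - IccExtend hℓ.le (T^[n] v) t|
        ≤ ∫ t in (0 : ℝ)..x, K ^ n / n.factorial * dist u v * t ^ n := by
      refine intervalIntegral.integral_mono_on x.2.1
        (Continuous.intervalIntegrable ((T^[n] u).continuous.Icc_extend'.sub
          (T^[n] v).continuous.Icc_extend').abs _ _)
        (Continuous.intervalIntegrable (by fun_prop) _ _) fun t ht => ?_
      have htℓ : t ∈ Icc 0 ℓ := ⟨ht.1, ht.2.trans x.2.2⟩
      rw [IccExtend_eqOn hℓ _ htℓ, IccExtend_eqOn hℓ _ htℓ]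
      refine (ih ⟨t, htℓ⟩).trans_eq ?_
      rw [mul_pow]
      ring
    rw [intervalIntegral.integral_const_mul, integral_pow] at hint
    refine (hT _ _ x).trans ((mul_le_mul_of_nonneg_left hint hK).trans_eq ?_)
    rw [Nat.factorial_succ]
    push_cast
    field_simp
    ring

theorem IsVolterra.exists_fixedPoint (hT : IsVolterra hℓ K T) (hK : 0 ≤ K) : ∃ u, T u = u := by
  obtain ⟨n, hn⟩ := ((FloorSemiring.tendsto_pow_div_factorial_atTop (K * ℓ)).eventually_lt_const
    one_pos).exists
  have hn_nonneg : 0 ≤ (K * ℓ) ^ n / n.factorial := by positivity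
  have hcontr : ContractingWith ⟨(K * ℓ) ^ n / n.factorial, hn_nonneg⟩ T^[n] := by
    refine ⟨hn, LipschitzWith.of_dist_le_mul fun u v => ?_⟩
    refine (ContinuousMap.dist_le (by positivity)).2 fun x => ?_
    have hx_nonneg : 0 ≤ K * x := mul_nonneg hK x.2.1
    have hx_le : K * x ≤ K * ℓ := mul_le_mul_of_nonneg_left x.2.2 hK
    calc dist (T^[n] u x) (T^[n] v x) ≤ (K * x) ^ n / n.factorial * dist u v :=
          hT.abs_iterate_sub_le hK n u v x
      _ ≤ (K * ℓ) ^ n / n.factorial * dist u v := by gcongr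
  exact ⟨_, hcontr.isFixedPt_fixedPoint_iterate⟩

end Volterra

theorem ae_norm_le_norm {α E : Type*} [MeasurableSpace α] [NormedAddCommGroup E] {ν : Measure α}
    (p : Lp E ∞ ν) : ∀ᵐ x ∂ν, ‖p x‖ ≤ ‖p‖ := by
  filter_upwards [ae_le_eLpNormEssSup (f := p) (μ := ν)] with x hx
  rw [← eLpNorm_exponent_top] at hx
  have hle := ENNReal.toReal_mono (Lp.eLpNorm_ne_top p) hx
  rwa [toReal_enorm, ← Lp.norm_def] at hle

section InitialValueProblem

variable {ℓ : ℝ} (hℓ : 0 < ℓ) (c : C(Icc (0 : ℝ) ℓ, ℝ)) (hc : ∀ x, c x ≠ 0)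
  (p : Lp ℝ ∞ (volume.restrict (Ioo (0 : ℝ) ℓ))) (μ : ℝ) (h : L2 ℓ) (α β : ℝ)

/-- The pointwise reciprocal `1 / c` of a nowhere vanishing continuous function. -/
def reciprocal : C(Icc (0 : ℝ) ℓ, ℝ) := ⟨fun x => (c x)⁻¹, c.continuous.inv₀ hc⟩

theorem mul_reciprocal_mul (F : C(Icc (0 : ℝ) ℓ, ℝ)) : c * (reciprocal c hc * F) = F :=
  ContinuousMap.ext fun x => mul_inv_cancel_left₀ (hc x) (F x)

/-- The derivative of the flux of a solution `u` of `μ u - ((c u')' - p u) = h`. -/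
def fluxDeriv (u : L2 ℓ) : L2 ℓ := mulBdd p u + μ • u - h

/-- The flux with initial value `β` that the equation `μ u - ((c u')' - p u) = h` prescribes when
`u` is substituted in the terms of order zero. -/
def picardFlux (u : C(Icc (0 : ℝ) ℓ, ℝ)) : C(Icc (0 : ℝ) ℓ, ℝ) :=
  primitive hℓ β (fluxDeriv p μ h (contToL2 hℓ u))

/-- The Picard map whose fixed points solve the initial value problem `μ u - ((c u')' - p u) = h`,
`u(0) = α`, `(c u')(0) = β`. -/
def picardMap (u : C(Icc (0 : ℝ) ℓ, ℝ)) : C(Icc (0 : ℝ) ℓ, ℝ) :=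
  primitive hℓ α (contToL2 hℓ (reciprocal c hc * picardFlux hℓ p μ h β u))

theorem ae_abs_fluxDeriv_sub_le (u v : L2 ℓ) : ∀ᵐ t ∂(volume.restrict (Ioo 0 ℓ)),
    |fluxDeriv p μ h u t - fluxDeriv p μ h v t| ≤ (‖p‖ + |μ|) * |u t - v t| := by
  have hsub : fluxDeriv p μ h u - fluxDeriv p μ h v = mulBdd p (u - v) + μ • (u - v) := by
    rw [fluxDeriv, fluxDeriv, sub_sub_sub_cancel_right, add_sub_add_comm, map_sub, smul_sub]
  filter_upwards [Lp.coeFn_sub (fluxDeriv p μ h u) (fluxDeriv p μ h v),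
    Lp.coeFn_add (mulBdd p (u - v)) (μ • (u - v)), Lp.coeFn_smul μ (u - v), Lp.coeFn_sub u v,
    mulBdd_ae_eq p (u - v), ae_norm_le_norm p] with t hflux hadd hsmul huv hmul hp
  calc |fluxDeriv p μ h u t - fluxDeriv p μ h v t| = |(p t + μ) * (u t - v t)| := by
        rw [← Pi.sub_apply, ← hflux, hsub, hadd, Pi.add_apply, hsmul, Pi.smul_apply, hmul, huv,
          Pi.sub_apply, smul_eq_mul, add_mul]
    _ ≤ (|p t| + |μ|) * |u t - v t| := by
        rw [abs_mul]
        gcongr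
        exact abs_add_le _ _
    _ ≤ (‖p‖ + |μ|) * |u t - v t| := by
        gcongr
        exact hp

theorem abs_picardFlux_sub_le (u v : C(Icc (0 : ℝ) ℓ, ℝ)) {s x : Icc (0 : ℝ) ℓ}
    (hsx : (s : ℝ) ≤ x) :
    |picardFlux hℓ p μ h β u s - picardFlux hℓ p μ h β v s| ≤
      (‖p‖ + |μ|) * ∫ t in (0 : ℝ)..x, |IccExtend hℓ.le u t - IccExtend hℓ.le v t| := by
  have hcont : Continuous fun t => |IccExtend hℓ.le u t - IccExtend hℓ.le v t| :=
    (u.continuous.Icc_extend'.sub v.continuous.Icc_extend').abs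
  have hle := abs_primitive_sub_le hℓ β (x := s) (hcont.const_mul (‖p‖ + |μ|)) (by
    filter_upwards [ae_abs_fluxDeriv_sub_le p μ h (contToL2 hℓ u) (contToL2 hℓ v),
      contToL2_ae_eq hℓ u, contToL2_ae_eq hℓ v] with t ht hu hv _
    rwa [hu, hv] at ht)
  rw [intervalIntegral.integral_const_mul] at hle
  refine hle.trans ?_
  gcongr
  exact intervalIntegral.integral_mono_interval le_rfl s.2.1 hsx
    (ae_of_all _ fun t => abs_nonneg _) (hcont.intervalIntegrable _ _)

theorem isVolterra_picardMap :
    IsVolterra hℓ (‖reciprocal c hc‖ * (‖p‖ + |μ|) * ℓ) (picardMap hℓ c hc p μ h α β) := by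
  intro u v x
  set I : ℝ := ∫ t in (0 : ℝ)..x, |IccExtend hℓ.le u t - IccExtend hℓ.le v t|
  have hI_nonneg : 0 ≤ I := intervalIntegral.integral_nonneg x.2.1 fun t _ => abs_nonneg _
  have hle := abs_primitive_sub_le hℓ α (x := x)
    (g := contToL2 hℓ (reciprocal c hc * picardFlux hℓ p μ h β u))
    (g' := contToL2 hℓ (reciprocal c hc * picardFlux hℓ p μ h β v))
    (continuous_const (y := ‖reciprocal c hc‖ * ((‖p‖ + |μ|) * I))) (by
    filter_upwards [contToL2_ae_eq hℓ (reciprocal c hc * picardFlux hℓ p μ h β u),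
      contToL2_ae_eq hℓ (reciprocal c hc * picardFlux hℓ p μ h β v),
      ae_restrict_mem measurableSet_Ioo] with t hu hv ht htx
    have htℓ := Ioo_subset_Icc_self ht
    rw [hu, hv, IccExtend_eqOn hℓ _ htℓ, IccExtend_eqOn hℓ _ htℓ, ContinuousMap.mul_apply,
      ContinuousMap.mul_apply, ← mul_sub, abs_mul]
    exact mul_le_mul ((reciprocal c hc).norm_coe_le_norm _)
      (abs_picardFlux_sub_le hℓ p μ h β u v (s := ⟨t, htℓ⟩) htx) (abs_nonneg _) (norm_nonneg _))
  rw [intervalIntegral.integral_const, sub_zero, smul_eq_mul] at hle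
  calc |picardMap hℓ c hc p μ h α β u x - picardMap hℓ c hc p μ h α β v x|
      ≤ x * (‖reciprocal c hc‖ * ((‖p‖ + |μ|) * I)) := hle
    _ ≤ ℓ * (‖reciprocal c hc‖ * ((‖p‖ + |μ|) * I)) := by
        gcongr
        exact x.2.2
    _ = ‖reciprocal c hc‖ * (‖p‖ + |μ|) * ℓ * I := by ring

theorem exists_edgeFlux_eq_contToL2 {U W : C(Icc (0 : ℝ) ℓ, ℝ)} {g : L2 ℓ}
    (hU : HasWeakDeriv (contToL2 hℓ U) (contToL2 hℓ (reciprocal c hc * W)))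
    (hW : HasWeakDeriv (contToL2 hℓ W) g) :
    ∃ u : edgeDomain hℓ c, (u : L2 ℓ) = contToL2 hℓ U ∧
      (edgeFlux hℓ c u : L2 ℓ) = contToL2 hℓ W := by
  have hflux : mulBdd (contToLinf hℓ c) (weakDeriv ℓ ⟨contToL2 hℓ U, _, hU⟩) = contToL2 hℓ W := by
    rw [HasWeakDeriv.weakDeriv_eq (f := ⟨contToL2 hℓ U, _, hU⟩) hU, mulBdd_contToLinf_contToL2,
      mul_reciprocal_mul]
  refine ⟨⟨contToL2 hℓ U, mem_edgeDomain.2 ⟨⟨_, hU⟩, ?_⟩⟩, rfl, hflux⟩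
  rw [hflux]
  exact ⟨_, hW⟩

end InitialValueProblem

theorem exists_edge_solution {ℓ : ℝ} (hℓ : 0 < ℓ) (c : C(Icc (0 : ℝ) ℓ, ℝ)) (hc : ∀ x, c x ≠ 0)
    (p : Lp ℝ ∞ (volume.restrict (Ioo (0 : ℝ) ℓ))) (μ : ℝ) (h : L2 ℓ) (α β : ℝ) :
    ∃ u : edgeDomain hℓ c, μ • (u : L2 ℓ) - edgeOp hℓ c p u = h ∧
      edgeVal hℓ c ⟨0, le_rfl, hℓ.le⟩ u = α ∧
      contRep hℓ (edgeFlux hℓ c u) ⟨0, le_rfl, hℓ.le⟩ = β := by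
  obtain ⟨U, hU⟩ := (isVolterra_picardMap hℓ c hc p μ h α β).exists_fixedPoint (by positivity)
  have hU_deriv := hasWeakDeriv_contToL2_primitive hℓ α
    (contToL2 hℓ (reciprocal c hc * picardFlux hℓ p μ h β U))
  have hW_deriv := hasWeakDeriv_contToL2_primitive hℓ β (fluxDeriv p μ h (contToL2 hℓ U))
  rw [← picardMap, hU] at hU_deriv
  rw [← picardFlux] at hW_deriv
  obtain ⟨u, hu, hflux⟩ := exists_edgeFlux_eq_contToL2 hℓ c hc hU_deriv hW_deriv
  refine ⟨u, ?_, ?_, ?_⟩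
  · have hop : edgeOp hℓ c p u = fluxDeriv p μ h u - mulBdd p u := by
      rw [← hu, ← hflux] at hW_deriv
      exact congrArg (· - mulBdd p (u : L2 ℓ)) hW_deriv.weakDeriv_eq
    rw [hop, fluxDeriv]
    abel
  · have hrep : contRep hℓ (Submodule.inclusion (edgeDomain_le hℓ c) u) = U :=
      contRep_eq_of_eq_contToL2 hℓ hu
    rw [← primitive_zero hℓ α (contToL2 hℓ (reciprocal c hc * picardFlux hℓ p μ h β U)),
      ← picardMap, hU, ← hrep]
    rfl
  · rw [contRep_eq_of_eq_contToL2 hℓ hflux, picardFlux, primitive_zero]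

section Green

theorem integral_mul_const_add_integral {f g : ℝ → ℝ} {a b : ℝ}
    (hf : IntervalIntegrable f volume a b) (hg : IntervalIntegrable g volume a b) (r s : ℝ) :
    ∫ x in a..b, f x * (s + ∫ t in a..x, g t)
      = (r + ∫ t in a..b, f t) * (s + ∫ t in a..b, g t) - r * s
        - ∫ x in a..b, (r + ∫ t in a..x, f t) * g x := by
  have hac {k : ℝ → ℝ} (hk : IntervalIntegrable k volume a b) (q : ℝ) :
      AbsolutelyContinuousOnInterval (fun x => q + ∫ t in a..x, k t) a b :=
    (LipschitzWith.const q).lipschitzOnWith.absolutelyContinuousOnInterval.add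
      (hk.absolutelyContinuousOnInterval_intervalIntegral left_mem_uIcc)
  have hderiv {k : ℝ → ℝ} (hk : IntervalIntegrable k volume a b) (q : ℝ) :
      ∀ᵐ x, x ∈ uIoc a b → deriv (fun x => q + ∫ t in a..x, k t) x = k x := by
    filter_upwards [hk.ae_hasDerivAt_integral] with x hx hxab
    exact ((hx (uIoc_subset_uIcc hxab) a left_mem_uIcc).const_add q).deriv
  have hparts := (hac hg s).integral_mul_deriv_eq_deriv_mul (hac hf r)
  rw [intervalIntegral.integral_same, intervalIntegral.integral_same, add_zero, add_zero] at hparts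
  calc ∫ x in a..b, f x * (s + ∫ t in a..x, g t)
      = ∫ x in a..b, (s + ∫ t in a..x, g t) * deriv (fun x => r + ∫ t in a..x, f t) x := by
        refine intervalIntegral.integral_congr_ae ?_
        filter_upwards [hderiv hf r] with x hx hxab
        rw [hx hxab, mul_comm]
    _ = (s + ∫ t in a..b, g t) * (r + ∫ t in a..b, f t) - s * r
        - ∫ x in a..b, deriv (fun x => s + ∫ t in a..x, g t) x * (r + ∫ t in a..x, f t) := hparts
    _ = (r + ∫ t in a..b, f t) * (s + ∫ t in a..b, g t) - r * s
        - ∫ x in a..b, (r + ∫ t in a..x, f t) * g x := by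
        rw [mul_comm (s + _), mul_comm s]
        congr 1
        refine intervalIntegral.integral_congr_ae ?_
        filter_upwards [hderiv hg s] with x hx hxab
        rw [hx hxab, mul_comm]

variable {ℓ : ℝ}

theorem inner_mulBdd_nonneg {a : Lp ℝ ∞ (volume.restrict (Ioo (0 : ℝ) ℓ))}
    (ha : ∀ᵐ x ∂(volume.restrict (Ioo 0 ℓ)), 0 ≤ a x) (f : L2 ℓ) :
    0 ≤ inner ℝ (mulBdd a f) f := by
  rw [MeasureTheory.L2.inner_def]
  refine integral_nonneg_of_ae ?_
  filter_upwards [ha, mulBdd_ae_eq a f] with x hax hx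
  calc
    0 ≤ a x * (f x * f x) := mul_nonneg hax (mul_self_nonneg _)
    _ = inner ℝ (mulBdd a f x) (f x) := by
        rw [hx, ← mul_assoc, mul_comm]
        rfl

theorem L2.inner_eq_intervalIntegral (hℓ : 0 < ℓ) (f g : L2 ℓ) :
    inner ℝ f g = ∫ x in (0 : ℝ)..ℓ, f x * g x := by
  rw [MeasureTheory.L2.inner_def, intervalIntegral.integral_of_le hℓ.le,
    integral_Ioc_eq_integral_Ioo]
  exact integral_congr_ae (ae_of_all _ fun x => mul_comm _ _)

theorem contRep_eq_add_integral (hℓ : 0 < ℓ) (f : H1 ℓ) (x : Icc (0 : ℝ) ℓ) :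
    contRep hℓ f x = contRep hℓ f ⟨0, le_rfl, hℓ.le⟩ + ∫ t in (0 : ℝ)..x, weakDeriv ℓ f t := by
  obtain ⟨a, ha⟩ := contRep_eq_primitive hℓ f
  rw [ha, ha, intervalIntegral.integral_same, add_zero]

theorem ae_eq_add_integral_weakDeriv (hℓ : 0 < ℓ) (f : H1 ℓ) : ∀ᵐ x, x ∈ uIoc 0 ℓ →
    (f : L2 ℓ) x
      = contRep hℓ f ⟨0, le_rfl, hℓ.le⟩ + ∫ t in (0 : ℝ)..x, weakDeriv ℓ f t := by
  rw [uIoc_of_le hℓ.le]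
  filter_upwards [ae_Ioc_of_ae_Ioo (contRep_ae_eq hℓ f)] with x hx hxℓ
  rw [hx hxℓ, IccExtend_eqOn hℓ _ (Ioc_subset_Icc_self hxℓ), contRep_eq_add_integral]

theorem inner_weakDeriv_left (hℓ : 0 < ℓ) (f g : H1 ℓ) :
    inner ℝ (weakDeriv ℓ f) (g : L2 ℓ)
      = contRep hℓ f ⟨ℓ, hℓ.le, le_rfl⟩ * contRep hℓ g ⟨ℓ, hℓ.le, le_rfl⟩
        - contRep hℓ f ⟨0, le_rfl, hℓ.le⟩ * contRep hℓ g ⟨0, le_rfl, hℓ.le⟩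
        - inner ℝ (f : L2 ℓ) (weakDeriv ℓ g) := by
  have hleft : inner ℝ (weakDeriv ℓ f) (g : L2 ℓ) = ∫ x in (0 : ℝ)..ℓ, weakDeriv ℓ f x *
      (contRep hℓ g ⟨0, le_rfl, hℓ.le⟩ + ∫ t in (0 : ℝ)..x, weakDeriv ℓ g t) := by
    rw [L2.inner_eq_intervalIntegral hℓ]
    refine intervalIntegral.integral_congr_ae ?_
    filter_upwards [ae_eq_add_integral_weakDeriv hℓ g] with x hx hxℓ
    rw [hx hxℓ]
  have hright : inner ℝ (f : L2 ℓ) (weakDeriv ℓ g) = ∫ x in (0 : ℝ)..ℓ,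
      (contRep hℓ f ⟨0, le_rfl, hℓ.le⟩ + ∫ t in (0 : ℝ)..x, weakDeriv ℓ f t) *
        weakDeriv ℓ g x := by
    rw [L2.inner_eq_intervalIntegral hℓ]
    refine intervalIntegral.integral_congr_ae ?_
    filter_upwards [ae_eq_add_integral_weakDeriv hℓ f] with x hx hxℓ
    rw [hx hxℓ]
  rw [hleft, hright, contRep_eq_add_integral hℓ f ⟨ℓ, hℓ.le, le_rfl⟩,
    contRep_eq_add_integral hℓ g ⟨ℓ, hℓ.le, le_rfl⟩]
  exact integral_mul_const_add_integral (L2.intervalIntegrable hℓ.le _)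
    (L2.intervalIntegrable hℓ.le _) _ _

theorem inner_edgeOp_le (hℓ : 0 < ℓ) {c : C(Icc (0 : ℝ) ℓ, ℝ)} (hc : ∀ x, 0 ≤ c x)
    {p : Lp ℝ ∞ (volume.restrict (Ioo (0 : ℝ) ℓ))}
    (hp : ∀ᵐ x ∂(volume.restrict (Ioo 0 ℓ)), 0 ≤ p x) (u : edgeDomain hℓ c) :
    inner ℝ (edgeOp hℓ c p u) (u : L2 ℓ)
      ≤ contRep hℓ (edgeFlux hℓ c u) ⟨ℓ, hℓ.le, le_rfl⟩ * edgeVal hℓ c ⟨ℓ, hℓ.le, le_rfl⟩ u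
        - contRep hℓ (edgeFlux hℓ c u) ⟨0, le_rfl, hℓ.le⟩ * edgeVal hℓ c ⟨0, le_rfl, hℓ.le⟩ u := by
  let u₁ := Submodule.inclusion (edgeDomain_le hℓ c) u
  have hparts : inner ℝ (weakDeriv ℓ (edgeFlux hℓ c u)) (u : L2 ℓ)
      = contRep hℓ (edgeFlux hℓ c u) ⟨ℓ, hℓ.le, le_rfl⟩ * edgeVal hℓ c ⟨ℓ, hℓ.le, le_rfl⟩ u
        - contRep hℓ (edgeFlux hℓ c u) ⟨0, le_rfl, hℓ.le⟩ * edgeVal hℓ c ⟨0, le_rfl, hℓ.le⟩ u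
        - inner ℝ (edgeFlux hℓ c u : L2 ℓ) (weakDeriv ℓ u₁) :=
    inner_weakDeriv_left hℓ (edgeFlux hℓ c u) u₁
  have hflux : 0 ≤ inner ℝ (edgeFlux hℓ c u : L2 ℓ) (weakDeriv ℓ u₁) := by
    refine inner_mulBdd_nonneg ?_ (weakDeriv ℓ u₁)
    filter_upwards [contToLinf_ae_eq hℓ c, ae_restrict_mem measurableSet_Ioo] with x hx hxℓ
    rw [hx, IccExtend_eqOn hℓ _ (Ioo_subset_Icc_self hxℓ)]
    exact hc _
  have hpot : 0 ≤ inner ℝ (mulBdd p (u : L2 ℓ)) (u : L2 ℓ) := inner_mulBdd_nonneg hp _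
  have hsub : inner ℝ (edgeOp hℓ c p u) (u : L2 ℓ)
      = inner ℝ (weakDeriv ℓ (edgeFlux hℓ c u)) (u : L2 ℓ)
        - inner ℝ (mulBdd p (u : L2 ℓ)) (u : L2 ℓ) := inner_sub_left _ _ _
  linarith

end Green

section ContMatrix

variable {d : ℕ} {U : Fin d → ℝ}

theorem contMatrix_mulVec (U : Fin d → ℝ) (i : Fin (d - 1)) :
    (QuantumGraph.contMatrix d).mulVec U i = U ⟨i, by omega⟩ - U ⟨i + 1, by omega⟩ := by
  have hterm (j : Fin d) : QuantumGraph.contMatrix d i j * U j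
      = (if j = ⟨i, by omega⟩ then U j else 0) - if j = ⟨i + 1, by omega⟩ then U j else 0 := by
    simp only [QuantumGraph.contMatrix, Matrix.of_apply, Fin.ext_iff]
    split_ifs <;> first | omega | ring
  simp only [Matrix.mulVec, dotProduct, hterm, Finset.sum_sub_distrib, Finset.sum_ite_eq',
    Finset.mem_univ, if_true]

theorem eq_of_contMatrix_mulVec_eq_zero (h : (QuantumGraph.contMatrix d).mulVec U = 0)
    (i j : Fin d) : U i = U j := by
  have hfirst (k : ℕ) (hk : k < d) : U ⟨k, hk⟩ = U ⟨0, by omega⟩ := by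
    induction k with
    | zero => rfl
    | succ k ih =>
      have hstep := congrFun h ⟨k, by omega⟩
      rw [contMatrix_mulVec, Pi.zero_apply, sub_eq_zero] at hstep
      rw [← ih (by omega), hstep]
  exact (hfirst i i.2).trans (hfirst j j.2).symm

end ContMatrix

namespace QuantumGraph

variable {V : Type*} [Fintype V] [DecidableEq V] (Γ : QuantumGraph V)

theorem src_ne_tgt (e : Γ.graph.edgeSet) : Γ.src e ≠ Γ.tgt e := by
  have h := e.2
  rw [← Γ.ends e, SimpleGraph.mem_edgeSet] at h
  exact h.ne

theorem mem_edge_iff (v : V) (e : Γ.graph.edgeSet) :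
    v ∈ (e : Sym2 V) ↔ v = Γ.src e ∨ v = Γ.tgt e := by
  rw [← Γ.ends e, Sym2.mem_iff]

theorem sum_sum_enum {α : Type*} [AddCommMonoid α] (φ : V → Γ.graph.edgeSet → α) :
    ∑ v, ∑ i, φ v (Γ.enum v i) = ∑ e, (φ (Γ.src e) e + φ (Γ.tgt e) e) := by
  have henum (v : V) : ∑ i, φ v (Γ.enum v i) =
      ∑ e : Γ.graph.edgeSet, if v ∈ (e : Sym2 V) then φ v e else 0 := by
    rw [← Finset.sum_filter, Equiv.sum_comp (Γ.enum v) fun e => φ v e]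
    exact (Finset.sum_subtype _ (by simp) _).symm
  simp_rw [henum]
  rw [Finset.sum_comm]
  refine Finset.sum_congr rfl fun e _ => ?_
  rw [← Finset.sum_filter, ← Finset.sum_pair (f := fun v => φ v e) (Γ.src_ne_tgt e)]
  refine Finset.sum_congr ?_ fun _ _ => rfl
  ext v
  simp [mem_edge_iff]

theorem endpoint_src (e : Γ.graph.edgeSet) :
    Γ.endpoint (Γ.src e) e = ⟨0, le_rfl, (Γ.length_pos e).le⟩ := if_pos rfl

theorem endpoint_tgt (e : Γ.graph.edgeSet) :
    Γ.endpoint (Γ.tgt e) e = ⟨Γ.length e, (Γ.length_pos e).le, le_rfl⟩ :=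
  if_neg (Γ.src_ne_tgt e)

theorem outward_src (e : Γ.graph.edgeSet) : Γ.outward (Γ.src e) e = 1 := if_pos rfl

theorem outward_tgt (e : Γ.graph.edgeSet) : Γ.outward (Γ.tgt e) e = -1 :=
  if_neg (Γ.src_ne_tgt e)

/-- The flux `c_e u_e'` of `u` out of the vertex `v` into the incident edge `e`. -/
def outFlux (u : Γ.Amax.domain) (v : V) (e : Γ.graph.edgeSet) : ℝ :=
  Γ.outward v e * contRep (Γ.length_pos e) (edgeFlux (Γ.length_pos e) (Γ.cond e) (Γ.comp e u))
    (Γ.endpoint v e)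

theorem kirchhoffOp_apply (u : Γ.Amax.domain) (v : V) :
    Γ.kirchhoffOp u v = ∑ i, Γ.outFlux u v (Γ.enum v i) := by
  change ∑ i, Γ.condRow v i * Γ.vertexDeriv v u i = _
  refine Finset.sum_congr rfl fun i _ => ?_
  change Γ.cond _ (Γ.endpoint v _) * (Γ.outward v _ * (_ / Γ.cond _ (Γ.endpoint v _))) = _
  rw [mul_left_comm, mul_div_cancel₀ _ (Γ.cond_pos _ _).ne']
  rfl

theorem inner_Amax_le (u : Γ.Amax.domain) : inner ℝ (Γ.Amax u) (u : Γ.H)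
    ≤ -∑ v, ∑ i, Γ.outFlux u v (Γ.enum v i) * Γ.vertexVal v u i := by
  let val (v : V) (e : Γ.graph.edgeSet) : ℝ :=
    edgeVal (Γ.length_pos e) (Γ.cond e) (Γ.endpoint v e) (Γ.comp e u)
  calc inner ℝ (Γ.Amax u) (u : Γ.H)
      ≤ ∑ e, -(Γ.outFlux u (Γ.src e) e * val (Γ.src e) e
          + Γ.outFlux u (Γ.tgt e) e * val (Γ.tgt e) e) := by
        rw [PiLp.inner_apply]
        refine Finset.sum_le_sum fun e _ => (inner_edgeOp_le (Γ.length_pos e)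
          (fun x => (Γ.cond_pos e x).le) (Γ.pot_nonneg e) (Γ.comp e u)).trans_eq ?_
        simp only [outFlux, val, endpoint_src, endpoint_tgt, outward_src, outward_tgt]
        ring
    _ = -∑ v, ∑ i, Γ.outFlux u v (Γ.enum v i) * val v (Γ.enum v i) := by
        rw [Finset.sum_neg_distrib, Γ.sum_sum_enum fun v e => Γ.outFlux u v e * val v e]

theorem sum_outFlux_mul_vertexVal_eq_zero {u : Γ.Amax.domain} (hcont : Γ.contOp u = 0)
    (hkir : Γ.kirchhoffOp u = 0) (v : V) :
    ∑ i, Γ.outFlux u v (Γ.enum v i) * Γ.vertexVal v u i = 0 := by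
  have hcont_v : (contMatrix (Γ.graph.degree v)).mulVec (Γ.vertexVal v u) = 0 :=
    funext fun k => congrFun hcont ⟨v, k⟩
  have hval (i j) : Γ.vertexVal v u i = Γ.vertexVal v u j :=
    eq_of_contMatrix_mulVec_eq_zero hcont_v i j
  rcases isEmpty_or_nonempty (Fin (Γ.graph.degree v)) with _ | ⟨⟨i₀⟩⟩
  · exact Finset.sum_of_isEmpty _
  · simp_rw [fun i => hval i i₀]
    rw [← Finset.sum_mul, ← kirchhoffOp_apply, hkir, Pi.zero_apply, zero_mul]

theorem B_eq_zero_iff (u : Γ.Amax.domain) :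
    Γ.B u = 0 ↔ Γ.contOp u = 0 ∧ Γ.kirchhoffOp u = 0 := by
  constructor
  · intro h
    exact ⟨funext fun i => congrArg (fun y : Γ.Y => y (Sum.inl i)) h,
      funext fun v => congrArg (fun y : Γ.Y => y (Sum.inr v)) h⟩
  · rintro ⟨hcont, hkir⟩
    ext (i | v)
    · exact congrFun hcont i
    · exact congrFun hkir v

theorem mem_domain_AKmax (u : Γ.Amax.domain) :
    (u : Γ.H) ∈ Γ.AKmax.domain ↔ Γ.contOp u = 0 :=
  mem_domain_kerRestrict.trans ⟨fun ⟨_, h⟩ => h, fun h => ⟨u.2, h⟩⟩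

theorem BK_apply (u : Γ.Amax.domain) (hu : (u : Γ.H) ∈ Γ.AKmax.domain) :
    Γ.BK ⟨u, hu⟩ = WithLp.toLp 2 (Γ.kirchhoffOp u) := rfl

theorem AK_eq_A : Γ.AK = Γ.A := by
  refine kerRestrict_eq_kerRestrict_of_le kerRestrict_le fun u => ?_
  rw [B_eq_zero_iff, ← mem_domain_AKmax, ← exists_prop]
  refine exists_congr fun hu => ?_
  rw [BK_apply, WithLp.toLp_eq_zero]

theorem A_le_Amax : Γ.A ≤ Γ.Amax := kerRestrict_le

theorem inner_A_nonpos (x : Γ.A.domain) : inner ℝ (Γ.A x) (x : Γ.H) ≤ 0 := by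
  obtain ⟨hx, hBx⟩ := mem_domain_kerRestrict.1 x.2
  obtain ⟨hcont, hkir⟩ := (Γ.B_eq_zero_iff _).1 hBx
  calc inner ℝ (Γ.A x) (x : Γ.H) = inner ℝ (Γ.Amax ⟨x, hx⟩) (x : Γ.H) := by
        rw [Γ.A_le_Amax.2 (x := x) (y := ⟨x, hx⟩) rfl]
    _ ≤ -∑ v, ∑ i, Γ.outFlux ⟨x, hx⟩ v (Γ.enum v i) * Γ.vertexVal v ⟨x, hx⟩ i :=
        Γ.inner_Amax_le ⟨x, hx⟩
    _ = 0 := by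
        simp only [Γ.sum_outFlux_mul_vertexVal_eq_zero hcont hkir, Finset.sum_const_zero, neg_zero]

theorem isDissipative_A : IsDissipative Γ.A := isDissipative_of_inner_nonpos Γ.inner_A_nonpos

/-- The value `u_e(0)` and the flux `(c_e u_e')(0)` at the initial point of every edge `e`: the
data that determine a solution of `μ u - A_max u = h`. -/
def initialData : Γ.Amax.domain →ₗ[ℝ] (Γ.graph.edgeSet → ℝ × ℝ) where
  toFun u e := (edgeVal (Γ.length_pos e) (Γ.cond e) ⟨0, le_rfl, (Γ.length_pos e).le⟩ (Γ.comp e u),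
    contRep (Γ.length_pos e) (edgeFlux (Γ.length_pos e) (Γ.cond e) (Γ.comp e u))
      ⟨0, le_rfl, (Γ.length_pos e).le⟩)
  map_add' u w := by
    funext e
    have h : Γ.comp e (u + w) = Γ.comp e u + Γ.comp e w := rfl
    ext <;> simp [h]
  map_smul' r u := by
    funext e
    have h : Γ.comp e (r • u) = r • Γ.comp e u := rfl
    ext <;> simp [h]

theorem exists_subOp_Amax_eq (μ : ℝ) (h : Γ.H) (a : Γ.graph.edgeSet → ℝ × ℝ) :
    ∃ u, subOp Γ.Amax μ u = h ∧ Γ.initialData u = a := by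
  choose u hu hval hflux using fun e => exists_edge_solution (Γ.length_pos e) (Γ.cond e)
    (fun x => (Γ.cond_pos e x).ne') (Γ.pot e) μ (h e) (a e).1 (a e).2
  refine ⟨⟨WithLp.toLp 2 fun e => (u e : L2 (Γ.length e)), fun e => (u e).2⟩, ?_, ?_⟩
  · ext1 e
    exact hu e
  · funext e
    exact Prod.ext (hval e) (hflux e)

theorem surjective_subOp_Amax (μ : ℝ) : Function.Surjective (subOp Γ.Amax μ) := fun h =>
  (Γ.exists_subOp_Amax_eq μ h 0).imp fun _ hu => hu.1

theorem surjective_initialData_ker (μ : ℝ) :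
    Function.Surjective (Γ.initialData.domRestrict (LinearMap.ker (subOp Γ.Amax μ))) := fun a => by
  obtain ⟨u, hu, hua⟩ := Γ.exists_subOp_Amax_eq μ 0 a
  exact ⟨⟨u, hu⟩, hua⟩

variable {Γ}

theorem bijective_B_ker (hdeg : ∀ v, 0 < Γ.graph.degree v) {μ : ℝ} (hμ : 0 < μ) :
    Function.Bijective (Γ.B.domRestrict (LinearMap.ker (subOp Γ.Amax μ))) := by
  refine bijective_of_injective_of_surjective_of_finrank_le
    (injective_domRestrict_ker (Γ.isDissipative_A.injective_subOp hμ))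
    (Γ.surjective_initialData_ker μ) ?_
  rw [Γ.finrank_Y hdeg, Module.finrank_pi_fintype]
  simp only [Module.finrank_prod, Module.finrank_self, Finset.sum_const, Finset.card_univ,
    smul_eq_mul, mul_comm, one_add_one_eq_two, le_refl]

theorem surjective_B (hdeg : ∀ v, 0 < Γ.graph.degree v) : Function.Surjective Γ.B := fun y =>
  let ⟨u, hu⟩ := (bijective_B_ker hdeg one_pos).2 y
  ⟨u, hu⟩

theorem surjective_BK (hdeg : ∀ v, 0 < Γ.graph.degree v) : Function.Surjective Γ.BK := by
  intro y
  obtain ⟨u, hu⟩ := surjective_B hdeg (WithLp.toLp 2 (Sum.elim 0 y))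
  have hcont : Γ.contOp u = 0 := funext fun i => congrArg (fun z : Γ.Y => z (Sum.inl i)) hu
  refine ⟨⟨u, (Γ.mem_domain_AKmax u).2 hcont⟩, ?_⟩
  rw [BK_apply]
  ext v
  exact congrArg (fun z : Γ.Y => z (Sum.inr v)) hu

theorem surjective_subOp_A (hdeg : ∀ v, 0 < Γ.graph.degree v) {μ : ℝ} (hμ : 0 < μ) :
    Function.Surjective (subOp Γ.A μ) :=
  surjective_subOp_kerRestrict (Γ.surjective_subOp_Amax μ) (bijective_B_ker hdeg hμ).2

theorem mem_resolventSet_A (hdeg : ∀ v, 0 < Γ.graph.degree v) {μ : ℝ} (hμ : 0 < μ) :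
    μ ∈ resolventSet Γ.A :=
  let ⟨_, hR⟩ := Γ.isDissipative_A.exists_isResolvent hμ (surjective_subOp_A hdeg hμ)
  hR.mem_resolventSet

theorem generatesC0Semigroup_A (hdeg : ∀ v, 0 < Γ.graph.degree v) :
    GeneratesC0Semigroup Γ.A :=
  generatesC0Semigroup_of_inner_nonpos Γ.inner_A_nonpos fun _ hμ => surjective_subOp_A hdeg hμ

end QuantumGraph

end QG

end

theorem mainTheorem7 {V : Type*} [Fintype V] [DecidableEq V] (Γ : QG.QuantumGraph V)
    (hdeg : ∀ v, 0 < Γ.graph.degree v) :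
    (QG.GeneratesC0Semigroup Γ.A ∧
      ∀ μ ∈ QG.resolventSet Γ.A, ∃ D : Γ.Y →L[ℝ] Γ.H, QG.IsDirichletOperator Γ.Amax Γ.B μ D) ∧
    (Γ.AK = Γ.A ∧ QG.GeneratesC0Semigroup Γ.AK ∧
      ∀ μ : ℝ, 0 < μ ∨ μ ∈ QG.resolventSet Γ.AK →
        ∃ D : Γ.YK →L[ℝ] Γ.H, QG.IsDirichletOperator Γ.AKmax Γ.BK μ D) := by
  have hgen : QG.GeneratesC0Semigroup Γ.A := QG.QuantumGraph.generatesC0Semigroup_A hdeg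
  have hpos {μ : ℝ} (hμ : 0 < μ) : μ ∈ QG.resolventSet Γ.AK :=
    Γ.AK_eq_A ▸ QG.QuantumGraph.mem_resolventSet_A hdeg hμ
  exact ⟨⟨hgen, fun _ hμ => QG.exists_isDirichletOperator (QG.QuantumGraph.surjective_B hdeg) hμ⟩,
    Γ.AK_eq_A, Γ.AK_eq_A ▸ hgen, fun _ hμ =>
      QG.exists_isDirichletOperator (QG.QuantumGraph.surjective_BK hdeg) (hμ.elim hpos id)⟩
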